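/- Let $D=[0,1]$ with the Euclidean distance, or $D=\mathbb{T}^1=\mathbb{R}/\mathbb{Z}$ with the flat (arc length) distance, and let $\mathfrak m$ be the Lebesgue measure on $D$, so that $\mathfrak m(D)=1$. Let $X_1,X_2,\dots$ be independent random variables in $D$ with law $\mathfrak m$, let $\mu^n=\frac1n\sum_{i=1}^n\delta_{X_i}$, and let $$W_2^2(\mu,\nu)=\inf\Big\{\int_{D\times D}d(x,y)^2\,\mathrm d\Sigma(x,y)\;:\;\Sigma\text{ a Borel measure on }D\times D\text{ with marginals }\mu\text{ and }\nu\Big\}.$$ Let $\Delta$ be the Laplacian on $L^2(D,\mathfrak m)$, with Neumann boundary conditions if $D=[0,1]$; that is, $u$ is in the domain of $\Delta$ and $\Delta u=f\in L^2(D,\mathfrak m)$ if and only if $u\in H^1(D)$ and $\int_D u'w'\,\mathrm d\mathfrak m=-\int_D f\,w\,\mathrm d\mathfrak m$ for all $w\in H^1(D)$. Then the spectrum $\sigma(\Delta)$ consists of eigenvalues of finite multiplicity, and $W_2^2(\mu^n,\mathfrak m)$ is an integrable random variable for every $n\ge 1$. Moreover $$\lim_{n\to\infty}n\,\mathbb E\big[W_2^2(\mu^n,\mathfrak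 m)\big]=-\sum_{\lambda\in\sigma(\Delta)\setminus\{0\}}\frac1\lambda,$$ where the eigenvalues are counted with multiplicity and the series converges. The limit equals $1/6$ if $D=[0,1]$ and $1/12$ if $D=\mathbb{T}^1$. -/

import Mathlib

open MeasureTheory ProbabilityTheory Filter Topology
open scoped ENNReal InnerProductSpace

noncomputable section

namespace RandomMatching

/-! ### Empirical measures and the quadratic Wasserstein distance -/

section Transport

variable {D : Type*} [MeasurableSpace D]

/-- The empirical measure `(1/n) ∑_{i < n} δ_{x i}` of the first `n` points of a sequence. -/
def empiricalMeasure (x : ℕ → D) (n : ℕ) : Measure D :=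
  (n : ℝ≥0∞)⁻¹ • ∑ i ∈ Finset.range n, Measure.dirac (x i)

/-- The transport plans (couplings) between `μ` and `ν`: the measures on `D × D` with first
marginal `μ` and second marginal `ν`. -/
def transportPlans (μ ν : Measure D) : Set (Measure (D × D)) :=
  {S | S.map Prod.fst = μ ∧ S.map Prod.snd = ν}

/-- The squared quadratic Wasserstein distance: the infimum (attained on the
spaces below) of `∫ d(x,y)² dS(x,y)` among all
transport plans `S` between `μ` and `ν`. -/
def wassersteinSq [PseudoEMetricSpace D] (μ ν : Measure D) : ℝ≥0∞ :=
  ⨅ S ∈ transportPlans μ ν, ∫⁻ p, edist p.1 p.2 ^ 2 ∂S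

end Transport

/-! ### Unbounded operators on a Hilbert space, represented by their graphs -/

section Operators

variable {H : Type*} [NormedAddCommGroup H] [InnerProductSpace ℝ H]

/-- The weak derivative determined by a set `T` of pairs `(φ, φ')` (test functions with their
classical derivatives): the pairs `(u, v)` with `∫ u φ' = - ∫ v φ` for every test function `φ`.
The first components that occur form the Sobolev space `H¹`. -/
def weakDerivGraph (T : Set (H × H)) : Submodule ℝ (H × H) where
  carrier := {p | ∀ t ∈ T, ⟪p.1, t.2⟫_ℝ = -⟪p.2, t.1⟫_ℝ}
  zero_mem' := by intro t _; simp
  add_mem' := by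
    intro a b ha hb t ht
    simp only [Prod.fst_add, Prod.snd_add, inner_add_left, ha t ht, hb t ht]
    ring
  smul_mem' := by
    intro c a ha t ht
    simp only [Prod.smul_fst, Prod.smul_snd, real_inner_smul_left, ha t ht]
    ring

/-- The Laplacian attached to the graph `G` of a weak derivative (the generator of the gradient
flow of the Dirichlet energy `½ ∫ |u'|²` on all of `H¹`): the pairs `(u, f)` such that `u ∈ H¹` and
`∫ u' w' = - ∫ f w` for every `w ∈ H¹`, i.e. the pairs `(u, Δ u)` with `u` in the domain
of `Δ`. On a domain with boundary this is the Laplacian with Neumann boundary conditions. -/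
def laplacianGraph (G : Submodule ℝ (H × H)) : Submodule ℝ (H × H) where
  carrier := {p | ∃ v, (p.1, v) ∈ G ∧ ∀ w ∈ G, ⟪v, w.2⟫_ℝ = -⟪p.2, w.1⟫_ℝ}
  zero_mem' := ⟨0, G.zero_mem, by intro w _; simp⟩
  add_mem' := by
    rintro a b ⟨v, hv, ha⟩ ⟨v', hv', hb⟩
    refine ⟨v + v', G.add_mem hv hv', fun w hw => ?_⟩
    simp only [Prod.snd_add, inner_add_left, ha w hw, hb w hw]
    ring
  smul_mem' := by
    rintro c a ⟨v, hv, ha⟩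
    refine ⟨c • v, G.smul_mem c hv, fun w hw => ?_⟩
    simp only [Prod.smul_snd, real_inner_smul_left, ha w hw]
    ring

/-- The spectrum of the operator `A` with graph `A`: the real numbers `l` for which `A - l` is not
a bijection from its domain onto `H` with bounded inverse `R`. -/
def operatorSpectrum (A : Submodule ℝ (H × H)) : Set ℝ :=
  {l | ¬ ∃ R : H →L[ℝ] H, ∀ u g : H, (u, g + l • u) ∈ A ↔ u = R g}

/-- The eigenspace of the operator `A` with graph `A`: the vectors `u` with `A u = l u`. -/
def operatorEigenspace (A : Submodule ℝ (H × H)) (l : ℝ) : Submodule ℝ H :=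
  A.comap (LinearMap.prod LinearMap.id (l • LinearMap.id))

/-- The multiplicity of `l` as an eigenvalue of `A`. -/
def multiplicity (A : Submodule ℝ (H × H)) (l : ℝ) : ℕ :=
  Module.finrank ℝ (operatorEigenspace A l)

end Operators

/-! ### The Laplacian on `[0,1]` and on the flat circle of length one -/

/-- The Hilbert space `L²(D, m)`, where `m` is the reference volume of `D`. -/
abbrev L2 (D : Type*) [MeasureSpace D] : Type _ := Lp ℝ 2 (volume : Measure D)

/-- The test functions on `[0,1]`, with their derivatives: smooth functions with compact support
in the open interval `(0,1)`. -/
def intervalTests : Set (L2 unitInterval × L2 unitInterval) :=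
  {t | ∃ φ : ℝ → ℝ, ContDiff ℝ ((⊤ : ℕ∞) : WithTop ℕ∞) φ ∧ tsupport φ ⊆ Set.Ioo 0 1 ∧
    (t.1 =ᵐ[volume] fun x : unitInterval => φ x) ∧
    (t.2 =ᵐ[volume] fun x : unitInterval => deriv φ x)}

/-- The test functions on the circle `ℝ / ℤ`, with their derivatives: smooth functions on the
line that are periodic with period one. -/
def circleTests : Set (L2 UnitAddCircle × L2 UnitAddCircle) :=
  {t | ∃ φ φ' : UnitAddCircle → ℝ, ContDiff ℝ ((⊤ : ℕ∞) : WithTop ℕ∞) (fun s : ℝ => φ s) ∧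
    (∀ s : ℝ, φ' s = deriv (fun r : ℝ => φ r) s) ∧
    t.1 =ᵐ[volume] φ ∧ t.2 =ᵐ[volume] φ'}

/-- The graph of the Laplacian on `[0,1]` with Neumann boundary conditions. -/
def intervalLaplacian : Submodule ℝ (L2 unitInterval × L2 unitInterval) :=
  laplacianGraph (weakDerivGraph intervalTests)

/-- The graph of the Laplacian on the circle `ℝ / ℤ`. -/
def circleLaplacian : Submodule ℝ (L2 UnitAddCircle × L2 UnitAddCircle) :=
  laplacianGraph (weakDerivGraph circleTests)

/-- `∑_{l ∈ σ(A) ∖ {0}} 1 / l`, term by term: the eigenvalue `l` is counted with its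
multiplicity. -/
def spectralTerm {H : Type*} [NormedAddCommGroup H] [InnerProductSpace ℝ H]
    (A : Submodule ℝ (H × H)) (l : ↥(operatorSpectrum A \ {0})) : ℝ :=
  (multiplicity A l : ℝ) * (1 / (l : ℝ))

end RandomMatching

end

namespace RandomMatching

noncomputable section

/-! ### Diagonal operators: Laplacian, spectrum and multiplicities in a Hilbert basis. -/

section SpectralTheory

variable {H : Type*} [NormedAddCommGroup H] [InnerProductSpace ℝ H] {ι : Type*}

/-! In dimension one both sides can be computed exactly, and `n * E[W₂²]` does not depend on `n ≥
1`; the limit is that of an eventually constant sequence.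

Transport side. A Kantorovich potential `φ` with `φ'' = 2 (1 - μⁿ)` is explicit. On the interval it
is `w²` minus twice the primitive of the empirical distribution function; on the circle it is the
average of the periodic Bernoulli polynomial `B₂` centred at the sample points. It certifies
(`wassersteinSq_eq_of_potential`) that the map sending the `i`-th cell of length `1/n` to the `i`-th
sorted point is optimal; on the circle the cells start at the origin `a = mean - 1/2`. The cost
involves the sorted sum `∑ (2i+1) x_i`, which equals the symmetric double sum of `max (x_i) (x_j)`
(`sum_sum_max_of_sorted`). Hence `W₂²` is a combination of symmetric sums, and its expectation needs
only one- and two-point moments of uniform variables (`uniform_moments`). The terms of order one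
cancel and leave `1/(6n)` and `1/(12n)`.

Spectral side. The Laplacian is diagonal in the cosines on the interval and in `cos + sin` on the
circle (`mem_laplacianGraph_iff`), and Stone–Weierstrass makes these families Hilbert bases. The
nonzero eigenvalues are `-(π k)²`, simple, and `-(2 π k)²`, double, with `k ≥ 1`, so that `ζ(2) =
π²/6` gives the same `1/6` and `1/12`. -/

theorem isClosed_weakDerivGraph (T : Set (H × H)) :
    IsClosed (weakDerivGraph T : Set (H × H)) := by
  have : (weakDerivGraph T : Set (H × H)) =
      ⋂ t ∈ T, {p : H × H | ⟪p.1, t.2⟫_ℝ = -⟪p.2, t.1⟫_ℝ} := by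
    ext p
    simp [weakDerivGraph]
  rw [this]
  refine isClosed_biInter fun t _ => isClosed_eq (by fun_prop) (by fun_prop)

/-- The Laplacian of a closed derivative graph is diagonal in any Hilbert basis `e` that comes with
derivatives `d` and satisfies the weak eigenvalue equation `∫ w' e' = - λ ∫ w e`. -/
theorem mem_laplacianGraph_iff [CompleteSpace H] (e : HilbertBasis ι ℝ H) (lam : ι → ℝ)
    (d : ι → H) {G : Submodule ℝ (H × H)} (hG : IsClosed (G : Set (H × H)))
    (hed : ∀ k, (e k, d k) ∈ G)
    (hd : ∀ w ∈ G, ∀ k, ⟪w.2, d k⟫_ℝ = -(lam k * ⟪w.1, e k⟫_ℝ)) (u f : H) :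
    (u, f) ∈ laplacianGraph G ↔ ∀ k, ⟪f, e k⟫_ℝ = lam k * ⟪u, e k⟫_ℝ := by
  classical
  constructor
  · rintro ⟨v, hv, h⟩ k
    have h1 := h _ (hed k)
    have h2 := hd _ hv k
    simp only at h1 h2
    linarith
  · intro h
    set a : ι → ℝ := fun k => ⟪u, e k⟫_ℝ with ha
    have hu : HasSum (fun k => a k • e k) u := by
      have := e.hasSum_repr u
      simpa [e.repr_apply_apply, ha, real_inner_comm] using this
    -- The `d k` are not assumed orthogonal: the weak equation turns the squared norm of a partial
    -- sum of derivatives into a partial sum of the Parseval series of `⟪f, u⟫`, which converges.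
    -- This yields the Cauchy property of the series for `u'`.
    have hfin : ∀ t : Finset ι, ‖∑ k ∈ t, a k • d k‖ ^ 2 = -∑ k ∈ t, ⟪f, e k⟫_ℝ * ⟪e k, u⟫_ℝ := by
      intro t
      have hw : ((∑ k ∈ t, a k • e k, ∑ k ∈ t, a k • d k) : H × H) ∈ G := by
        have : ((∑ k ∈ t, a k • e k, ∑ k ∈ t, a k • d k) : H × H)
            = ∑ k ∈ t, a k • (e k, d k) := by
          ext <;> simp [Prod.fst_sum, Prod.snd_sum]
        rw [this]
        exact G.sum_mem fun k _ => G.smul_mem _ (hed k)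
      rw [← real_inner_self_eq_norm_sq]
      conv_lhs => rw [inner_sum]
      rw [← Finset.sum_neg_distrib]
      refine Finset.sum_congr rfl fun k hk => ?_
      rw [inner_smul_right, hd _ hw k, h k]
      have : ⟪∑ k ∈ t, a k • e k, e k⟫_ℝ = a k := by
        have := e.orthonormal.inner_left_sum a hk
        simpa using this
      rw [this, real_inner_comm u (e k)]
      ring
    have hsum : Summable fun k => a k • d k := by
      rw [summable_iff_vanishing_norm]
      intro ε hε
      have hs := (e.summable_inner_mul_inner f u)
      rw [summable_iff_vanishing_norm] at hs
      obtain ⟨s, hs⟩ := hs (ε ^ 2) (by positivity)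
      refine ⟨s, fun t ht => ?_⟩
      have := hs t ht
      refine lt_of_pow_lt_pow_left₀ 2 hε.le ?_
      rw [hfin]
      refine lt_of_le_of_lt ?_ this
      exact neg_le_abs _
    obtain ⟨v, hv⟩ := hsum
    refine ⟨v, ?_, fun w hw => ?_⟩
    -- Finite sums lie in `G`, and closedness of the derivative graph passes to the limit.
    · refine hG.mem_of_tendsto (hu.prodMk hv) (Eventually.of_forall fun t => ?_)
      refine G.sum_mem fun k _ => ?_
      exact G.smul_mem (a k) (hed k)
    · have h1 : HasSum (fun k => ⟪w.2, a k • d k⟫_ℝ) ⟪w.2, v⟫_ℝ := by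
        exact (innerSL ℝ w.2).hasSum hv
      have h2 := (e.hasSum_inner_mul_inner f w.1).neg
      rw [real_inner_comm]
      refine h1.unique ?_
      refine h2.congr_fun fun k => ?_
      rw [inner_smul_right, hd w hw k, h k, real_inner_comm w.1 (e k)]
      ring

/-- A bounded diagonal operator in a Hilbert basis. -/
theorem exists_diagonal (e : HilbertBasis ι ℝ H) (c : ι → ℝ) {C : ℝ} (hC : ∀ k, |c k| ≤ C) :
    ∃ R : H →L[ℝ] H, ∀ g k, ⟪R g, e k⟫_ℝ = c k * ⟪g, e k⟫_ℝ := by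
  have hmem : ∀ g : lp (fun _ : ι => ℝ) 2, Memℓp (fun k => c k * g k) 2 := fun g =>
    ((lp.memℓp g).const_mul C).mono' fun k => by
      change ‖c k * g k‖ ≤ ‖C * g k‖
      rw [norm_mul, norm_mul]
      gcongr
      exact (hC k).trans (le_abs_self C)
  let M : lp (fun _ : ι => ℝ) 2 →ₗ[ℝ] lp (fun _ : ι => ℝ) 2 :=
    { toFun := fun g => ⟨fun k => c k * g k, hmem g⟩
      map_add' := fun g h => by ext k; exact mul_add _ _ _
      map_smul' := fun r g => by ext k; exact mul_left_comm _ _ _ }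
  have hM : ∀ g, ‖M g‖ ≤ |C| * ‖g‖ := by
    intro g
    have : ‖M g‖ ≤ ‖C • g‖ := by
      refine lp.norm_mono (by norm_num) fun k => ?_
      change ‖c k * g k‖ ≤ ‖C * g k‖
      rw [norm_mul, norm_mul]
      gcongr
      exact (hC k).trans (le_abs_self C)
    simpa [norm_smul] using this
  refine ⟨(e.repr.symm.toContinuousLinearEquiv : _ →L[ℝ] H) ∘L (M.mkContinuous _ hM) ∘L
    (e.repr.toContinuousLinearEquiv : H →L[ℝ] _), fun g k => ?_⟩
  rw [real_inner_comm, real_inner_comm (e k) g, ← e.repr_apply_apply, ← e.repr_apply_apply]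
  simp [M]

theorem eq_of_forall_inner_eq (e : HilbertBasis ι ℝ H) {u v : H}
    (h : ∀ k, ⟪u, e k⟫_ℝ = ⟪v, e k⟫_ℝ) : u = v := by
  apply e.repr.injective
  ext k
  rw [e.repr_apply_apply, e.repr_apply_apply, real_inner_comm, h k, real_inner_comm]

variable {A : Submodule ℝ (H × H)} (e : HilbertBasis ι ℝ H) {lam : ι → ℝ}

/-- The spectrum of a diagonal operator whose eigenvalues tend to infinity in modulus. -/
theorem operatorSpectrum_eq_range
    (hA : ∀ u f, (u, f) ∈ A ↔ ∀ k, ⟪f, e k⟫_ℝ = lam k * ⟪u, e k⟫_ℝ)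
    (hlam : Tendsto lam cofinite atBot) : operatorSpectrum A = Set.range lam := by
  ext l
  constructor
  · intro hl
    by_contra hr
    have hne : ∀ k, lam k - l ≠ 0 := fun k hk => hr ⟨k, sub_eq_zero.1 hk⟩
    -- The resolvent must be diagonal with these entries; they tend to zero, hence are bounded.
    have hlim : Tendsto (fun k => |(lam k - l)⁻¹|) cofinite (𝓝 0) := by
      have : Tendsto (fun k => lam k - l) cofinite atBot :=
        tendsto_atBot_add_const_right _ (-l) hlam
      simpa using (tendsto_inv_atBot_zero.comp this).abs
    obtain ⟨C, hC⟩ := hlim.bddAbove_range_of_cofinite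
    obtain ⟨R, hR⟩ := exists_diagonal e (fun k => (lam k - l)⁻¹) (C := C)
      fun k => hC ⟨k, rfl⟩
    refine hl ⟨R, fun u g => ?_⟩
    rw [hA]
    constructor
    · intro h
      refine eq_of_forall_inner_eq e fun k => ?_
      have := h k
      rw [inner_add_left, real_inner_smul_left] at this
      rw [hR, eq_inv_mul_iff_mul_eq₀ (hne k)]
      linarith
    · rintro rfl k
      rw [inner_add_left, real_inner_smul_left, hR]
      field_simp [hne k]
      ring
  · rintro ⟨k, rfl⟩ ⟨R, hR⟩
    -- An eigenvector is a second solution of `(A - l) u = 0`, so it would equal `R 0 = 0`.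
    have hmem : (e k, (0 : H) + lam k • e k) ∈ A :=
      (hA _ _).2 fun j => by
        rw [zero_add, real_inner_smul_left]
        by_cases hjk : j = k
        · rw [hjk]
        · rw [e.orthonormal.2 (Ne.symm hjk)]
          simp
    have := (hR _ _).1 hmem
    rw [map_zero] at this
    exact e.orthonormal.ne_zero k this

/-- The multiplicity of an eigenvalue of a diagonal operator. -/
theorem multiplicity_eq_ncard
    (hA : ∀ u f, (u, f) ∈ A ↔ ∀ k, ⟪f, e k⟫_ℝ = lam k * ⟪u, e k⟫_ℝ)
    (hlam : Tendsto lam cofinite atBot) (l : ℝ) :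
    multiplicity A l = {k | lam k = l}.ncard := by
  classical
  have hfin : {k | lam k = l}.Finite := by
    have := hlam.eventually (eventually_lt_atBot l)
    rw [eventually_cofinite] at this
    exact this.subset fun k (hk : lam k = l) => hk.not_lt
  have hspan : operatorEigenspace A l =
      Submodule.span ℝ (Set.range fun k : {k | lam k = l} => e k) := by
    apply le_antisymm
    · intro u hu
      have hu' : (u, l • u) ∈ A := hu
      rw [hA] at hu'
      -- Coefficients of an eigenvector vanish off the finite level set, so its expansion is a
      -- finite sum.
      have hzero : ∀ k, k ∉ hfin.toFinset → e.repr u k • e k = 0 := by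
        intro k hk
        have h1 := hu' k
        rw [real_inner_smul_left] at h1
        have h2 : (l - lam k) * ⟪u, e k⟫_ℝ = 0 := by linarith
        have h3 : l - lam k ≠ 0 := fun h => hk (by simp; linarith)
        rw [e.repr_apply_apply, real_inner_comm, (mul_eq_zero.1 h2).resolve_left h3, zero_smul]
      have : u = ∑ k ∈ hfin.toFinset, e.repr u k • e k :=
        (e.hasSum_repr u).unique (hasSum_sum_of_ne_finset_zero fun k hk => hzero k hk)
      rw [this]
      refine Submodule.sum_mem _ fun k hk => Submodule.smul_mem _ _ (Submodule.subset_span ?_)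
      exact ⟨⟨k, by simpa using hk⟩, rfl⟩
    · rw [Submodule.span_le]
      rintro _ ⟨⟨k, hk⟩, rfl⟩
      change (e k, l • e k) ∈ A
      refine (hA _ _).2 fun j => ?_
      rw [real_inner_smul_left]
      by_cases hjk : j = k
      · rw [hjk, hk]
      · rw [e.orthonormal.2 (Ne.symm hjk)]
        simp
  have : Fintype {k | lam k = l} := hfin.fintype
  have hli : LinearIndependent ℝ fun k : {k | lam k = l} => e k :=
    e.orthonormal.linearIndependent.comp _ Subtype.val_injective
  rw [multiplicity, hspan, finrank_span_eq_card hli, Set.ncard_eq_toFinset_card',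
    Set.toFinset_card]

end SpectralTheory

/-! ### Hilbert bases from Stone–Weierstrass. -/

section ContinuousBasis

variable {α ι : Type*} [TopologicalSpace α] [CompactSpace α] [MeasureSpace α]
  [BorelSpace α] [IsFiniteMeasure (volume : Measure α)]

/-- The class in `L²` of a continuous function. -/
abbrev contL2 (f : C(α, ℝ)) : L2 α := ContinuousMap.toLp 2 volume ℝ f

theorem inner_contL2 (w : L2 α) (f : C(α, ℝ)) : ⟪w, contL2 f⟫_ℝ = ∫ x, w x * f x := by
  rw [L2.inner_def]
  refine integral_congr_ae ?_
  filter_upwards [ContinuousMap.coeFn_toLp (p := 2) (𝕜 := ℝ) volume f] with x hx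
  rw [hx]
  simp [mul_comm]

theorem inner_contL2_contL2 (f g : C(α, ℝ)) : ⟪contL2 f, contL2 g⟫_ℝ = ∫ x, f x * g x := by
  rw [inner_contL2]
  refine integral_congr_ae ?_
  filter_upwards [ContinuousMap.coeFn_toLp (p := 2) (𝕜 := ℝ) volume f] with x hx
  rw [hx]

/-- An orthonormal family of continuous functions whose span is a point-separating algebra is a
Hilbert basis of `L²`. -/
theorem exists_hilbertBasis_of_continuous [T2Space α]
    [(volume : Measure α).WeaklyRegular] (f : ι → C(α, ℝ))
    (horth : Orthonormal ℝ fun k => contL2 (f k))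
    (hone : (1 : C(α, ℝ)) ∈ Submodule.span ℝ (Set.range f))
    (hmul : ∀ j k, f j * f k ∈ Submodule.span ℝ (Set.range f))
    (hsep : ∀ x y : α, (∀ k, f k x = f k y) → x = y) :
    ∃ b : HilbertBasis ι ℝ (L2 α), ∀ k, b k = contL2 (f k) := by
  set S := Submodule.span ℝ (Set.range f) with hS
  have hmulS : ∀ g h : C(α, ℝ), g ∈ S → h ∈ S → g * h ∈ S := by
    intro g h hg hh
    have h1 : S * S ≤ S := by
      rw [hS, Submodule.span_mul_span, Submodule.span_le]
      rintro _ ⟨_, ⟨j, rfl⟩, _, ⟨k, rfl⟩, rfl⟩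
      exact hmul j k
    exact h1 (Submodule.mul_mem_mul hg hh)
  -- The span itself is an algebra, so Stone–Weierstrass gives uniform density; continuous functions
  -- are dense in `L²`.
  let B : Subalgebra ℝ C(α, ℝ) := S.toSubalgebra hone hmulS
  have hB : B.SeparatesPoints := by
    intro x y hxy
    by_contra hcon
    refine hxy (hsep x y fun k => ?_)
    by_contra hk
    exact hcon ⟨f k, ⟨f k, Submodule.subset_span ⟨k, rfl⟩, rfl⟩, hk⟩
  have htop := ContinuousMap.subalgebra_topologicalClosure_eq_top_of_separatesPoints B hB
  have hSdense : Dense (S : Set C(α, ℝ)) := by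
    have : closure (B : Set C(α, ℝ)) = Set.univ := by
      have := congrArg (fun B : Subalgebra ℝ C(α, ℝ) => (B : Set C(α, ℝ))) htop
      simpa using this
    exact dense_iff_closure_eq.2 this
  have hdense : Dense ((fun g => contL2 g) '' (S : Set C(α, ℝ))) :=
    (ContinuousMap.toLp_denseRange ℝ volume ℝ (by simp)).dense_image
      (ContinuousMap.toLp 2 volume ℝ).continuous hSdense
  have hspan : ⊤ ≤ (Submodule.span ℝ (Set.range fun k => contL2 (f k))).topologicalClosure := by
    intro x _
    refine closure_mono ?_ (hdense x)
    rintro _ ⟨g, hg, rfl⟩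
    have : Submodule.map (ContinuousMap.toLp 2 volume ℝ : C(α, ℝ) →L[ℝ] L2 α).toLinearMap S =
        Submodule.span ℝ (Set.range fun k => contL2 (f k)) := by
      rw [hS, Submodule.map_span, ← Set.range_comp]
      rfl
    rw [SetLike.mem_coe, ← this]
    exact ⟨g, hg, rfl⟩
  exact ⟨HilbertBasis.mk horth hspan, fun k => by rw [HilbertBasis.coe_mk]⟩

end ContinuousBasis
-- The Laplacian on the circle.
section Circle

/-- The function `cos (2 π k x) + sin (2 π k x)` on the circle. -/
def cas (k : ℤ) : C(UnitAddCircle, ℝ) :=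
  ⟨fun x => (fourier k x : ℂ).re + (fourier k x : ℂ).im, by fun_prop⟩

theorem cas_coe (k : ℤ) (x : ℝ) :
    cas k (x : UnitAddCircle) = Real.cos (2 * Real.pi * k * x) + Real.sin (2 * Real.pi * k * x) := by
  change (fourier k (x : UnitAddCircle) : ℂ).re + (fourier k (x : UnitAddCircle) : ℂ).im = _
  rw [fourier_coe_apply]
  have : (2 * Real.pi * Complex.I * k * x / (1 : ℝ) : ℂ) = (2 * Real.pi * k * x : ℝ) * Complex.I := by
    push_cast
    ring
  rw [this, Complex.exp_ofReal_mul_I_re, Complex.exp_ofReal_mul_I_im]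

/-- Since `cos - sin` at `k` is `cas (-k)`, differentiation only flips the index. This makes a
single real family indexed by `ℤ` more convenient than separate sines and cosines. -/
theorem hasDerivAt_cas (k : ℤ) (x : ℝ) :
    HasDerivAt (fun r : ℝ => cas k (r : UnitAddCircle))
      (2 * Real.pi * k * cas (-k) (x : UnitAddCircle)) x := by
  simp only [cas_coe]
  have h : HasDerivAt (fun r : ℝ => 2 * Real.pi * k * r) (2 * Real.pi * k) x := by
    simpa using (hasDerivAt_id x).const_mul (2 * Real.pi * k)
  refine (h.cos.add h.sin).congr_deriv ?_
  have : 2 * Real.pi * ((-k : ℤ) : ℝ) * x = -(2 * Real.pi * k * x) := by push_cast; ring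
  rw [this, Real.cos_neg, Real.sin_neg]
  ring

theorem cas_mul (j k : ℤ) : cas j * cas k =
    (1 / 2 : ℝ) • (cas (j - k) + cas (k - j)) + (1 / 2 : ℝ) • (cas (j + k) - cas (-(j + k))) := by
  ext x
  induction x using QuotientAddGroup.induction_on with | _ x =>
  change cas j (x : UnitAddCircle) * cas k (x : UnitAddCircle) =
    1 / 2 * (cas (j - k) (x : UnitAddCircle) + cas (k - j) (x : UnitAddCircle)) +
    1 / 2 * (cas (j + k) (x : UnitAddCircle) - cas (-(j + k)) (x : UnitAddCircle))
  simp only [cas_coe]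
  push_cast
  have h1 : 2 * Real.pi * ((j : ℝ) - k) * x = 2 * Real.pi * j * x - 2 * Real.pi * k * x := by ring
  have h2 : 2 * Real.pi * ((k : ℝ) - j) * x = 2 * Real.pi * k * x - 2 * Real.pi * j * x := by ring
  have h3 : 2 * Real.pi * ((j : ℝ) + k) * x = 2 * Real.pi * j * x + 2 * Real.pi * k * x := by ring
  have h4 : 2 * Real.pi * (-((j : ℝ) + k)) * x = -(2 * Real.pi * j * x + 2 * Real.pi * k * x) := by
    ring
  rw [h1, h2, h3, h4, Real.cos_neg, Real.sin_neg, Real.cos_sub, Real.sin_sub, Real.cos_sub,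
    Real.sin_sub, Real.cos_add, Real.sin_add]
  ring

theorem integral_cas (k : ℤ) : ∫ x, cas k x = if k = 0 then 1 else 0 := by
  rw [← UnitAddCircle.intervalIntegral_preimage 0]
  split_ifs with hk
  · subst hk
    simp [cas_coe]
  · have hk' : (k : ℝ) ≠ 0 := by exact_mod_cast hk
    have hpi := Real.pi_ne_zero
    have : ∀ x : ℝ, x ∈ Set.uIcc (0 : ℝ) (0 + 1) → HasDerivAt
        (fun r : ℝ => -(2 * Real.pi * k)⁻¹ * cas (-k) (r : UnitAddCircle))
        (cas k (x : UnitAddCircle)) x := by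
      intro x _
      refine ((hasDerivAt_cas (-k) x).const_mul (-(2 * Real.pi * k)⁻¹)).congr_deriv ?_
      rw [neg_neg]
      push_cast
      field_simp
    rw [intervalIntegral.integral_eq_sub_of_hasDerivAt this]
    · have : ((0 + 1 : ℝ) : UnitAddCircle) = ((0 : ℝ) : UnitAddCircle) := by
        rw [AddCircle.coe_add, AddCircle.coe_period, add_zero]
      rw [this, sub_self]
    · exact Continuous.intervalIntegrable
        ((cas k).continuous.comp (AddCircle.continuous_mk' 1)) _ _

/-- Integration by parts on the circle. -/
theorem circle_integral_mul_deriv {f f' g g' : UnitAddCircle → ℝ}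
    (hf : ∀ s : ℝ, HasDerivAt (fun r : ℝ => f r) (f' s) s)
    (hg : ∀ s : ℝ, HasDerivAt (fun r : ℝ => g r) (g' s) s)
    (hf' : Continuous fun s : ℝ => f' s) (hg' : Continuous fun s : ℝ => g' s) :
    ∫ x, f x * g' x = -∫ x, f' x * g x := by
  rw [← UnitAddCircle.intervalIntegral_preimage 0, ← UnitAddCircle.intervalIntegral_preimage 0]
  rw [intervalIntegral.integral_mul_deriv_eq_deriv_mul (fun x _ => hf x) (fun x _ => hg x)
    (hf'.intervalIntegrable _ _) (hg'.intervalIntegrable _ _)]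
  have : ((0 + 1 : ℝ) : UnitAddCircle) = ((0 : ℝ) : UnitAddCircle) := by
    rw [AddCircle.coe_add, AddCircle.coe_period, add_zero]
  rw [this, sub_self, zero_sub]

theorem integral_cas_mul_cas (j k : ℤ) : ∫ x, cas j x * cas k x = if j = k then 1 else 0 := by
  have h : ∀ x, cas j x * cas k x = (1 / 2 * cas (j - k) x + 1 / 2 * cas (k - j) x) +
      (1 / 2 * cas (j + k) x - 1 / 2 * cas (-(j + k)) x) := fun x => by
    have := DFunLike.congr_fun (cas_mul j k) x
    simp only [ContinuousMap.coe_mul, Pi.mul_apply, ContinuousMap.coe_add, Pi.add_apply,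
      ContinuousMap.coe_smul, Pi.smul_apply, smul_eq_mul, ContinuousMap.coe_sub,
      Pi.sub_apply] at this
    rw [this]
    ring
  have hint : ∀ m, Integrable fun x => 1 / 2 * cas m x := fun m => Integrable.const_mul
    ((cas m).continuous.integrable_of_hasCompactSupport (HasCompactSupport.of_compactSpace _)) _
  simp only [h]
  have h1 : Integrable fun x => 1 / 2 * cas (j - k) x + 1 / 2 * cas (k - j) x :=
    (hint _).add (hint _)
  have h2 : Integrable fun x => 1 / 2 * cas (j + k) x - 1 / 2 * cas (-(j + k)) x :=
    (hint _).sub (hint _)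
  rw [integral_add h1 h2,
    integral_add (hint _) (hint _), integral_sub (hint _) (hint _)]
  simp only [integral_const_mul]
  simp only [integral_cas, neg_eq_zero, sub_self, add_zero, sub_eq_zero, eq_comm (a := k)]
  split_ifs <;> norm_num

theorem orthonormal_cas : Orthonormal ℝ fun k => contL2 (cas k) := by
  classical
  rw [orthonormal_iff_ite]
  intro j k
  rw [inner_contL2_contL2, integral_cas_mul_cas]

theorem exists_cas_basis : ∃ b : HilbertBasis ℤ ℝ (L2 UnitAddCircle),
    ∀ k, b k = contL2 (cas k) := by
  have hmem : ∀ k, cas k ∈ Submodule.span ℝ (Set.range cas) :=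
    fun k => Submodule.subset_span ⟨k, rfl⟩
  refine exists_hilbertBasis_of_continuous cas orthonormal_cas ?_ (fun j k => ?_) fun x y h => ?_
  · have : (1 : C(UnitAddCircle, ℝ)) = cas 0 := by
      ext x
      simp [cas]
    rw [this]
    exact hmem 0
  · rw [cas_mul]
    exact Submodule.add_mem _
      (Submodule.smul_mem _ _ (Submodule.add_mem _ (hmem _) (hmem _)))
      (Submodule.smul_mem _ _ (Submodule.sub_mem _ (hmem _) (hmem _)))
  -- The indices `1` and `-1` give `re + im` and `re - im` of the first character, which is
  -- injective.
  · have h1 : (fourier 1 x : ℂ).re + (fourier 1 x : ℂ).im =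
      (fourier 1 y : ℂ).re + (fourier 1 y : ℂ).im := h 1
    have h2 : (fourier (-1) x : ℂ).re + (fourier (-1) x : ℂ).im =
      (fourier (-1) y : ℂ).re + (fourier (-1) y : ℂ).im := h (-1)
    rw [fourier_neg, fourier_neg, Complex.conj_re, Complex.conj_im, Complex.conj_re,
      Complex.conj_im] at h2
    have h3 : (fourier 1 x : ℂ) = fourier 1 y := by
      apply Complex.ext <;> linarith
    rw [fourier_one, fourier_one] at h3
    exact AddCircle.injective_toCircle one_ne_zero (Subtype.ext h3)

theorem contL2_ae {α : Type*} [TopologicalSpace α] [CompactSpace α] [MeasureSpace α]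
    [BorelSpace α] [IsFiniteMeasure (volume : Measure α)] (f : C(α, ℝ)) :
    contL2 f =ᵐ[volume] f :=
  ContinuousMap.coeFn_toLp (p := 2) (𝕜 := ℝ) volume f

theorem contDiff_cas (k : ℤ) :
    ContDiff ℝ ((⊤ : ℕ∞) : WithTop ℕ∞) fun s : ℝ => cas k (s : UnitAddCircle) := by
  simp only [cas_coe]
  fun_prop

theorem mem_circleLaplacian_iff : ∃ b : HilbertBasis ℤ ℝ (L2 UnitAddCircle), ∀ u f,
    (u, f) ∈ circleLaplacian ↔
      ∀ k : ℤ, ⟪f, b k⟫_ℝ = -(2 * Real.pi * k) ^ 2 * ⟪u, b k⟫_ℝ := by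
  obtain ⟨b, hb⟩ := exists_cas_basis
  refine ⟨b, mem_laplacianGraph_iff b (fun k : ℤ => -(2 * Real.pi * k) ^ 2)
    (fun k => contL2 ((2 * Real.pi * k) • cas (-k))) (isClosed_weakDerivGraph _) ?_ ?_⟩
  -- The classical derivative is a weak one: integrate by parts, with no boundary terms by
  -- periodicity.
  · rintro k ⟨t₁, t₂⟩ ⟨φ, φ', hφ, hφ', h₁, h₂⟩
    simp only at h₁ h₂
    change ⟪b k, t₂⟫_ℝ = -⟪contL2 ((2 * Real.pi * k) • cas (-k)), t₁⟫_ℝ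
    have hd : ∀ s : ℝ, HasDerivAt (fun r : ℝ => φ r) (φ' s) s := fun s => by
      rw [hφ']
      exact (hφ.differentiable (by simp) s).hasDerivAt
    have hc : Continuous fun s : ℝ => φ' s := by
      simp only [hφ']
      exact hφ.continuous_deriv (by simp)
    rw [hb, real_inner_comm, inner_contL2, real_inner_comm, inner_contL2]
    have e1 : ∫ x, t₂ x * cas k x = ∫ x, cas k x * φ' x :=
      integral_congr_ae (by filter_upwards [h₂] with x hx; rw [hx, mul_comm])
    have e2 : ∫ x, t₁ x * ((2 * Real.pi * k) • cas (-k)) x =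
        ∫ x, (2 * Real.pi * k * cas (-k) x) * φ x :=
      integral_congr_ae (by filter_upwards [h₁] with x hx; rw [hx, mul_comm]; simp)
    rw [e1, e2]
    exact circle_integral_mul_deriv (fun s => hasDerivAt_cas k s) hd (by
      exact continuous_const.mul ((cas (-k)).continuous.comp (AddCircle.continuous_mk' 1))) hc
  · rintro w hw k
    -- The derivative of a basis function is itself an admissible test function, so the weak
    -- eigenvalue equation is the definition of `G` tested on it.
    have ht : (contL2 ((2 * Real.pi * k) • cas (-k)), contL2 (-(2 * Real.pi * k) ^ 2 • cas k)) ∈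
        circleTests := by
      refine ⟨_, _, ?_, fun s => ?_, contL2_ae _, contL2_ae _⟩
      · exact contDiff_const.mul (contDiff_cas (-k))
      · refine (HasDerivAt.deriv ?_).symm
        refine ((hasDerivAt_cas (-k) s).const_mul (2 * Real.pi * k)).congr_deriv ?_
        simp
        ring
    have := hw _ ht
    simp only [contL2, map_smul, inner_smul_right] at this ⊢
    rw [hb]
    linarith

end Circle

/-! ### The Neumann Laplacian on the unit interval. -/

section Interval

theorem integral_unitInterval (f : ℝ → ℝ) : ∫ x : unitInterval, f x = ∫ x in (0 : ℝ)..1, f x := by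
  rw [intervalIntegral.integral_of_le zero_le_one, ← integral_Icc_eq_integral_Ioc]
  exact unitInterval.measurePreserving_coe.integral_comp unitInterval.measurableEmbedding_coe f

/-- The restriction to the unit interval of a continuous function on the line. -/
def onUnitInterval (f : ℝ → ℝ) (hf : Continuous f) : C(unitInterval, ℝ) :=
  ⟨fun x => f x, hf.comp continuous_subtype_val⟩

/-- A smooth step from `0` on `(-∞, 1]` to `1` on `[2, ∞)`. -/
def step (s : ℝ) : ℝ := Real.smoothTransition (s - 1)

theorem contDiff_step : ContDiff ℝ ((⊤ : ℕ∞) : WithTop ℕ∞) step :=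
  Real.smoothTransition.contDiff.comp (contDiff_id.sub contDiff_const)

theorem step_eq_zero {s : ℝ} (hs : s ≤ 1) : step s = 0 :=
  Real.smoothTransition.zero_of_nonpos (by linarith)

theorem step_eq_one {s : ℝ} (hs : 2 ≤ s) : step s = 1 :=
  Real.smoothTransition.one_of_one_le (by linarith)

theorem deriv_step_of_lt {s : ℝ} (hs : s < 1) : deriv step s = 0 := by
  have : step =ᶠ[𝓝 s] fun _ => 0 := by
    filter_upwards [eventually_lt_nhds hs] with r hr using step_eq_zero hr.le
  rw [this.deriv_eq, deriv_const]

theorem deriv_step_of_gt {s : ℝ} (hs : 2 < s) : deriv step s = 0 := by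
  have : step =ᶠ[𝓝 s] fun _ => 1 := by
    filter_upwards [eventually_gt_nhds hs] with r hr using step_eq_one hr.le
  rw [this.deriv_eq, deriv_const]

theorem exists_bound_mul_deriv_step : ∃ M, ∀ s, |s * deriv step s| ≤ M := by
  have hc : Continuous fun s => s * deriv step s :=
    continuous_id.mul (contDiff_step.continuous_deriv (by simp))
  have hs : HasCompactSupport fun s => s * deriv step s := by
    refine HasCompactSupport.intro (isCompact_Icc (a := (1 : ℝ)) (b := 2)) fun s hs => ?_
    rw [Set.mem_Icc, not_and_or, not_le, not_le] at hs
    rcases hs with hs | hs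
    · rw [deriv_step_of_lt hs, mul_zero]
    · rw [deriv_step_of_gt hs, mul_zero]
  exact hc.bounded_above_of_compact_support hs

/-- A smooth function that vanishes at `0` and `1` is a limit of smooth functions with compact
support in `(0,1)`, boundedly together with the first derivative. -/
theorem exists_test_approximation {ψ : ℝ → ℝ} (hψ : ContDiff ℝ ((⊤ : ℕ∞) : WithTop ℕ∞) ψ)
    (h0 : ψ 0 = 0) (h1 : ψ 1 = 0) :
    ∃ φ : ℕ → ℝ → ℝ,
      (∀ n, ContDiff ℝ ((⊤ : ℕ∞) : WithTop ℕ∞) (φ n) ∧ tsupport (φ n) ⊆ Set.Ioo 0 1) ∧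
      (∃ C, ∀ n, ∀ x ∈ Set.Icc (0 : ℝ) 1, |φ n x| ≤ C ∧ |deriv (φ n) x| ≤ C) ∧
      ∀ x ∈ Set.Ioo (0 : ℝ) 1, ∀ᶠ n in atTop, φ n x = ψ x ∧ deriv (φ n) x = deriv ψ x := by
  have hdψ : Continuous (deriv ψ) := hψ.continuous_deriv (by simp)
  have hdiff : Differentiable ℝ ψ := hψ.differentiable (by simp)
  obtain ⟨L, hL⟩ := (isCompact_Icc (a := (0 : ℝ)) (b := 1)).exists_bound_of_continuousOn
    hdψ.continuousOn
  obtain ⟨M, hM⟩ := exists_bound_mul_deriv_step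
  have hL0 : 0 ≤ L := (norm_nonneg _).trans (hL 0 (by simp))
  have hlip : ∀ x ∈ Set.Icc (0 : ℝ) 1, ∀ y ∈ Set.Icc (0 : ℝ) 1, |ψ y - ψ x| ≤ L * |y - x| :=
    fun x hx y hy => (convex_Icc (0 : ℝ) 1).norm_image_sub_le_of_norm_deriv_le
      (fun z _ => hdiff z) hL hx hy
  -- Linear vanishing at both endpoints: this compensates the factor `n` in the derivative of the
  -- cutoff.
  have hbound : ∀ x ∈ Set.Icc (0 : ℝ) 1, |ψ x| ≤ 2 * L * (x * (1 - x)) := by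
    intro x hx
    have e0 := hlip 0 (by simp) x hx
    have e1 := hlip 1 (by simp) x hx
    rw [h0, sub_zero, sub_zero, abs_of_nonneg hx.1] at e0
    rw [h1, sub_zero, abs_of_nonpos (by linarith [hx.2] : x - 1 ≤ 0)] at e1
    have := mul_le_mul_of_nonneg_right e0 (by linarith [hx.2] : 0 ≤ 1 - x)
    have := mul_le_mul_of_nonneg_right e1 hx.1
    nlinarith
  have hq : ∀ (n : ℕ) (x : ℝ), HasDerivAt (fun x : ℝ => (n : ℝ) * (x * (1 - x)))
      ((n : ℝ) * (1 - 2 * x)) x := by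
    intro n x
    refine (((hasDerivAt_id x).mul ((hasDerivAt_const x 1).sub (hasDerivAt_id x))).const_mul
      (n : ℝ)).congr_deriv ?_
    simp only [id, Pi.sub_apply]
    ring
  have hderiv : ∀ (n : ℕ) (x : ℝ), deriv (fun x => ψ x * step (n * (x * (1 - x)))) x =
      deriv ψ x * step (n * (x * (1 - x))) +
        ψ x * (deriv step (n * (x * (1 - x))) * (n * (1 - 2 * x))) := by
    intro n x
    have hs := (contDiff_step.differentiable (by simp) (n * (x * (1 - x)))).hasDerivAt
    exact ((hdiff x).hasDerivAt.mul (HasDerivAt.comp x hs (hq n x))).deriv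
  have hstep : ∀ s, |step s| ≤ 1 := fun s => by
    change |Real.smoothTransition (s - 1)| ≤ 1
    rw [abs_of_nonneg (Real.smoothTransition.nonneg _)]
    exact Real.smoothTransition.le_one _
  -- The cutoff vanishes where `n x (1 - x) ≤ 1` and is `1` where `n x (1 - x) ≥ 2`; its transition
  -- layer shrinks to the endpoints.
  refine ⟨fun n x => ψ x * step (n * (x * (1 - x))), fun n => ⟨?_, ?_⟩,
    ⟨L + 2 * L * M, fun n x hx => ?_⟩, fun x hx => ?_⟩
  · exact hψ.mul (contDiff_step.comp (by fun_prop))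
  · have hcl : IsClosed {x : ℝ | 1 ≤ n * (x * (1 - x))} :=
      isClosed_le continuous_const (by fun_prop)
    refine (closure_minimal (fun x hx => ?_) hcl).trans fun x hx => ?_
    · by_contra hcon
      refine hx ?_
      change ψ x * step (n * (x * (1 - x))) = 0
      rw [step_eq_zero (not_le.1 hcon).le, mul_zero]
    · have hx' : 1 ≤ n * (x * (1 - x)) := hx
      have hn : (0 : ℝ) ≤ n := n.cast_nonneg
      have hpos : 0 < x * (1 - x) := by
        by_contra hcon
        nlinarith [mul_nonneg hn (sub_nonneg.2 (not_lt.1 hcon))]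
      constructor <;> nlinarith
  · have hq0 : 0 ≤ x * (1 - x) := mul_nonneg hx.1 (by linarith [hx.2])
    have hq1 : x * (1 - x) ≤ 1 / 2 := by nlinarith [sq_nonneg (x - 1 / 2)]
    have hM0 : 0 ≤ M := (abs_nonneg _).trans (hM 0)
    constructor
    · simp only [abs_mul]
      have e1 := hbound x hx
      have e2 : |ψ x| * |step (n * (x * (1 - x)))| ≤ |ψ x| * 1 := by
        gcongr
        exact hstep _
      have e3 : 2 * L * (x * (1 - x)) ≤ L := by nlinarith
      have e4 : 0 ≤ 2 * L * M := by positivity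
      linarith
    · rw [hderiv]
      refine (abs_add_le _ _).trans (add_le_add ?_ ?_)
      · rw [abs_mul]
        calc |deriv ψ x| * |step (n * (x * (1 - x)))| ≤ L * 1 := by
              gcongr
              · exact hL x hx
              · exact hstep _
          _ = L := mul_one L
      -- With `q = n x (1 - x)`, the dangerous term `ψ · step'(q) · n` is at most `2 L |q
      -- step'(q)|`, bounded uniformly in `n`.
      · have hM' := hM (n * (x * (1 - x)))
        have hx2 : |1 - 2 * x| ≤ 1 := abs_le.2 ⟨by linarith [hx.2], by linarith [hx.1]⟩
        rw [abs_mul, abs_mul, abs_mul, Nat.abs_cast]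
        rw [abs_mul, abs_mul, Nat.abs_cast, abs_of_nonneg hq0] at hM'
        calc |ψ x| * (|deriv step (n * (x * (1 - x)))| * (n * |1 - 2 * x|))
            ≤ 2 * L * (x * (1 - x)) * (|deriv step (n * (x * (1 - x)))| * (n * 1)) := by
              gcongr
              exact hbound x hx
          _ = 2 * L * (n * (x * (1 - x)) * |deriv step (n * (x * (1 - x)))|) := by ring
          _ ≤ 2 * L * M := by gcongr
  · have hq0 : 0 < x * (1 - x) := mul_pos hx.1 (by linarith [hx.2])
    obtain ⟨N, hN⟩ := exists_nat_gt (2 / (x * (1 - x)))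
    filter_upwards [eventually_ge_atTop N] with n hn
    have h2 : 2 < (n : ℝ) * (x * (1 - x)) := by
      rw [div_lt_iff₀ hq0] at hN
      have : (N : ℝ) ≤ n := by exact_mod_cast hn
      nlinarith
    rw [hderiv, step_eq_one h2.le, deriv_step_of_gt h2]
    simp

/-- Dominated convergence along the cutoffs. The derivatives of the cosines are sines, which vanish
at the endpoints without having compact support in the open interval, so they are not test
functions. -/
theorem weakDerivGraph_intervalTests_apply {w : L2 unitInterval × L2 unitInterval}
    (hw : w ∈ weakDerivGraph intervalTests) {ψ : ℝ → ℝ}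
    (hψ : ContDiff ℝ ((⊤ : ℕ∞) : WithTop ℕ∞) ψ) (h0 : ψ 0 = 0) (h1 : ψ 1 = 0) :
    ∫ x, w.1 x * deriv ψ x = -∫ x, w.2 x * ψ x := by
  obtain ⟨φ, hφ, ⟨C, hC⟩, hlim⟩ := exists_test_approximation hψ h0 h1
  have hint : ∀ v : L2 unitInterval, Integrable v := fun v =>
    (Lp.memLp v).integrable (by norm_num)
  have hIoo : ∀ᵐ x : unitInterval, (x : ℝ) ∈ Set.Ioo (0 : ℝ) 1 := by
    have h : ∀ y : unitInterval, ∀ᵐ x : unitInterval, x ≠ y := fun y =>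
      by simp [ae_iff]
    filter_upwards [h 0, h 1] with x hx0 hx1
    exact ⟨lt_of_le_of_ne x.2.1 fun h => hx0 (Subtype.ext h.symm),
      lt_of_le_of_ne x.2.2 fun h => hx1 (Subtype.ext h)⟩
  have hconv : ∀ (v : L2 unitInterval) (g : ℕ → ℝ → ℝ) (g₀ : ℝ → ℝ), (∀ n, Continuous (g n)) →
      (∀ n, ∀ x ∈ Set.Icc (0 : ℝ) 1, |g n x| ≤ C) →
      (∀ x ∈ Set.Ioo (0 : ℝ) 1, ∀ᶠ n in atTop, g n x = g₀ x) →
      Tendsto (fun n => ∫ x, v x * g n x) atTop (𝓝 (∫ x, v x * g₀ x)) := by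
    intro v g g₀ hg hb hl
    refine tendsto_integral_of_dominated_convergence (fun x => ‖v x‖ * C) (fun n => ?_)
      ((hint v).norm.mul_const C) (fun n => ?_) ?_
    · exact (hint v).aestronglyMeasurable.mul
        ((hg n).comp continuous_subtype_val).aestronglyMeasurable
    · refine Eventually.of_forall fun x => ?_
      rw [norm_mul]
      gcongr
      exact hb n x x.2
    · filter_upwards [hIoo] with x hx
      refine tendsto_const_nhds.congr' ?_
      filter_upwards [hl x hx] with n hn
      rw [hn]
  have hdc : ∀ n, Continuous (deriv (φ n)) := fun n => (hφ n).1.continuous_deriv (by simp)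
  have e1 := hconv w.1 (fun n => deriv (φ n)) (deriv ψ) hdc (fun n x hx => (hC n x hx).2)
    fun x hx => (hlim x hx).mono fun n h => h.2
  have e2 := hconv w.2 φ ψ (fun n => (hφ n).1.continuous) (fun n x hx => (hC n x hx).1)
    fun x hx => (hlim x hx).mono fun n h => h.1
  refine tendsto_nhds_unique e1 (e2.neg.congr fun n => ?_)
  have := hw (contL2 (onUnitInterval _ (hφ n).1.continuous), contL2 (onUnitInterval _ (hdc n)))
    ⟨φ n, (hφ n).1, (hφ n).2, contL2_ae _, contL2_ae _⟩
  rw [inner_contL2, inner_contL2] at this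
  exact this.symm

/-- The normalizing constant of the `k`-th cosine. -/
def cosNorm (k : ℕ) : ℝ := if k = 0 then 1 else √2

/-- The normalized cosine `c_k cos (π k x)` on the unit interval. -/
def cosine (k : ℕ) : C(unitInterval, ℝ) :=
  onUnitInterval (fun x => cosNorm k * Real.cos (Real.pi * k * x)) (by fun_prop)

theorem cosine_apply (k : ℕ) (x : unitInterval) :
    cosine k x = cosNorm k * Real.cos (Real.pi * k * x) := rfl

theorem integral_cos_int (m : ℤ) :
    ∫ x in (0 : ℝ)..1, Real.cos (Real.pi * m * x) = if m = 0 then 1 else 0 := by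
  split_ifs with hm
  · simp [hm]
  · have : Real.pi * (m : ℝ) ≠ 0 := mul_ne_zero Real.pi_ne_zero (by exact_mod_cast hm)
    rw [intervalIntegral.integral_comp_mul_left _ this]
    simp only [integral_cos, mul_zero, mul_one, Real.sin_zero, sub_zero]
    rw [mul_comm Real.pi, Real.sin_int_mul_pi, smul_zero]

theorem cos_mul_cos_nat (j k : ℕ) (x : ℝ) :
    Real.cos (Real.pi * j * x) * Real.cos (Real.pi * k * x) =
      1 / 2 * Real.cos (Real.pi * ((j - k : ℤ) : ℝ) * x) +
      1 / 2 * Real.cos (Real.pi * ((j + k : ℤ) : ℝ) * x) := by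
  push_cast
  rw [show Real.pi * ((j : ℝ) - k) * x = Real.pi * j * x - Real.pi * k * x by ring,
    show Real.pi * ((j : ℝ) + k) * x = Real.pi * j * x + Real.pi * k * x by ring,
    Real.cos_sub, Real.cos_add]
  ring

theorem orthonormal_cosine : Orthonormal ℝ fun k => contL2 (cosine k) := by
  rw [orthonormal_iff_ite]
  intro j k
  rw [inner_contL2_contL2]
  simp only [cosine_apply]
  rw [integral_unitInterval fun x => cosNorm j * Real.cos (Real.pi * j * x) *
    (cosNorm k * Real.cos (Real.pi * k * x))]
  have : ∀ x : ℝ, cosNorm j * Real.cos (Real.pi * j * x) *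
      (cosNorm k * Real.cos (Real.pi * k * x)) =
      cosNorm j * cosNorm k * (1 / 2 * Real.cos (Real.pi * ((j - k : ℤ) : ℝ) * x) +
      1 / 2 * Real.cos (Real.pi * ((j + k : ℤ) : ℝ) * x)) := fun x => by
    rw [← cos_mul_cos_nat]
    ring
  simp only [this]
  rw [intervalIntegral.integral_const_mul, intervalIntegral.integral_add
    (Continuous.intervalIntegrable (by fun_prop) _ _)
    (Continuous.intervalIntegrable (by fun_prop) _ _), intervalIntegral.integral_const_mul,
    intervalIntegral.integral_const_mul, integral_cos_int, integral_cos_int]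
  have hjk : (j : ℤ) - k = 0 ↔ j = k := by omega
  have hjk' : (j : ℤ) + k = 0 ↔ j = 0 ∧ k = 0 := by omega
  simp only [hjk, hjk', cosNorm]
  by_cases h : j = k
  · subst h
    by_cases h0 : j = 0
    · simp [h0]
      norm_num
    · simp [h0]
  · have : ¬(j = 0 ∧ k = 0) := by omega
    simp [h, this]

theorem exists_cosine_basis : ∃ b : HilbertBasis ℕ ℝ (L2 unitInterval),
    ∀ k, b k = contL2 (cosine k) := by
  have hmem : ∀ k, cosine k ∈ Submodule.span ℝ (Set.range cosine) :=
    fun k => Submodule.subset_span ⟨k, rfl⟩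
  have hnorm : ∀ k, cosNorm k ≠ 0 := fun k => by
    unfold cosNorm
    split_ifs <;> positivity
  have hmem' : ∀ m : ℤ, onUnitInterval (fun x => Real.cos (Real.pi * m * x)) (by fun_prop) ∈
      Submodule.span ℝ (Set.range cosine) := by
    intro m
    have : onUnitInterval (fun x => Real.cos (Real.pi * m * x)) (by fun_prop) =
        (cosNorm m.natAbs)⁻¹ • cosine m.natAbs := by
      ext x
      change Real.cos (Real.pi * m * x) =
        (cosNorm m.natAbs)⁻¹ * (cosNorm m.natAbs * Real.cos (Real.pi * m.natAbs * x))
      rw [inv_mul_cancel_left₀ (hnorm _)]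
      obtain ⟨n, rfl | rfl⟩ := m.eq_nat_or_neg
      · simp
      · simp
    rw [this]
    exact Submodule.smul_mem _ _ (hmem _)
  refine exists_hilbertBasis_of_continuous cosine orthonormal_cosine ?_ (fun j k => ?_)
    fun x y h => ?_
  · have : (1 : C(unitInterval, ℝ)) = cosine 0 := by
      ext x
      simp [cosine_apply, cosNorm]
    rw [this]
    exact hmem 0
  · have : cosine j * cosine k = (cosNorm j * cosNorm k * (1 / 2)) •
        (onUnitInterval (fun x => Real.cos (Real.pi * ((j - k : ℤ) : ℝ) * x)) (by fun_prop) +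
        onUnitInterval (fun x => Real.cos (Real.pi * ((j + k : ℤ) : ℝ) * x)) (by fun_prop)) := by
      ext x
      change cosNorm j * Real.cos (Real.pi * j * x) * (cosNorm k * Real.cos (Real.pi * k * x)) =
        cosNorm j * cosNorm k * (1 / 2) * (Real.cos (Real.pi * ((j - k : ℤ) : ℝ) * x) +
          Real.cos (Real.pi * ((j + k : ℤ) : ℝ) * x))
      have := cos_mul_cos_nat j k x
      linear_combination cosNorm j * cosNorm k * this
    rw [this]
    exact Submodule.smul_mem _ _ (Submodule.add_mem _ (hmem' _) (hmem' _))
  · have h1 := h 1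
    simp only [cosine_apply, Nat.cast_one, mul_one] at h1
    have h2 := mul_left_cancel₀ (hnorm 1) h1
    have hx : ∀ z : unitInterval, Real.pi * (z : ℝ) ∈ Set.Icc 0 Real.pi := fun z =>
      ⟨mul_nonneg Real.pi_pos.le z.2.1, mul_le_of_le_one_right Real.pi_pos.le z.2.2⟩
    exact Subtype.ext (mul_left_cancel₀ Real.pi_ne_zero (Real.injOn_cos (hx x) (hx y) h2))

theorem mem_intervalLaplacian_iff : ∃ b : HilbertBasis ℕ ℝ (L2 unitInterval), ∀ u f,
    (u, f) ∈ intervalLaplacian ↔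
      ∀ k : ℕ, ⟪f, b k⟫_ℝ = -(Real.pi * k) ^ 2 * ⟪u, b k⟫_ℝ := by
  obtain ⟨b, hb⟩ := exists_cosine_basis
  have hd : ∀ (k : ℕ) (x : ℝ), HasDerivAt (fun x => cosNorm k * Real.cos (Real.pi * k * x))
      (-(Real.pi * k * cosNorm k) * Real.sin (Real.pi * k * x)) x := by
    intro k x
    refine ((((hasDerivAt_id x).const_mul (Real.pi * k)).cos).const_mul (cosNorm k)).congr_deriv ?_
    simp
    ring
  have hd' : ∀ (k : ℕ) (x : ℝ), HasDerivAt
      (fun x => -(Real.pi * k * cosNorm k) * Real.sin (Real.pi * k * x))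
      (-(Real.pi * k) ^ 2 * (cosNorm k * Real.cos (Real.pi * k * x))) x := by
    intro k x
    refine ((((hasDerivAt_id x).const_mul (Real.pi * k)).sin).const_mul
      (-(Real.pi * k * cosNorm k))).congr_deriv ?_
    simp
    ring
  refine ⟨b, mem_laplacianGraph_iff b (fun k : ℕ => -(Real.pi * k) ^ 2)
    (fun k => contL2 (onUnitInterval
      (fun x => -(Real.pi * k * cosNorm k) * Real.sin (Real.pi * k * x)) (by fun_prop)))
    (isClosed_weakDerivGraph _) ?_ ?_⟩
  · rintro k ⟨t₁, t₂⟩ ⟨φ, hφ, hsupp, h₁, h₂⟩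
    simp only at h₁ h₂
    have hzero : ∀ x, x ∉ Set.Ioo (0 : ℝ) 1 → φ x = 0 := fun x hx =>
      image_eq_zero_of_notMem_tsupport fun h => hx (hsupp h)
    change ⟪b k, t₂⟫_ℝ = -⟪contL2 _, t₁⟫_ℝ
    rw [hb, real_inner_comm, inner_contL2, real_inner_comm, inner_contL2]
    have e1 : ∫ x, t₂ x * cosine k x =
        ∫ x in (0 : ℝ)..1, cosNorm k * Real.cos (Real.pi * k * x) * deriv φ x := by
      rw [← integral_unitInterval fun x => cosNorm k * Real.cos (Real.pi * k * x) * deriv φ x]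
      refine integral_congr_ae ?_
      filter_upwards [h₂] with x hx
      rw [hx, mul_comm, cosine_apply]
    have e2 : ∫ x, t₁ x * onUnitInterval
        (fun x => -(Real.pi * k * cosNorm k) * Real.sin (Real.pi * k * x)) (by fun_prop) x =
        ∫ x in (0 : ℝ)..1, -(Real.pi * k * cosNorm k) * Real.sin (Real.pi * k * x) * φ x := by
      rw [← integral_unitInterval fun x =>
        -(Real.pi * k * cosNorm k) * Real.sin (Real.pi * k * x) * φ x]
      refine integral_congr_ae ?_
      filter_upwards [h₁] with x hx
      rw [hx, mul_comm]
      rfl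
    rw [e1, e2, intervalIntegral.integral_mul_deriv_eq_deriv_mul (fun x _ => hd k x)
      (fun x _ => (hφ.differentiable (by simp) x).hasDerivAt)
      (Continuous.intervalIntegrable (by fun_prop) _ _)
      ((hφ.continuous_deriv (by simp)).intervalIntegrable _ _),
      hzero 0 (by simp), hzero 1 (by simp)]
    simp
  -- The sine vanishes at `0` and `1`, so it may be tested against an arbitrary `w` in `H¹`, with no
  -- boundary condition on `w`.
  · intro w hw k
    have := weakDerivGraph_intervalTests_apply hw
      (ψ := fun x => -(Real.pi * k * cosNorm k) * Real.sin (Real.pi * k * x))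
      (by fun_prop) (by simp) (by simp [mul_comm Real.pi, Real.sin_nat_mul_pi])
    simp only [(hd' k _).deriv] at this
    rw [hb, inner_contL2, inner_contL2]
    have e : ∫ x : unitInterval, w.1 x * (-(Real.pi * k) ^ 2 *
        (cosNorm k * Real.cos (Real.pi * k * x))) =
        -(Real.pi * k) ^ 2 * ∫ x, w.1 x * cosine k x := by
      rw [← integral_const_mul]
      refine integral_congr_ae (Eventually.of_forall fun x => ?_)
      simp only [cosine_apply]
      ring
    rw [e] at this
    rw [this, neg_neg]
    rfl

end Interval

/-! ### The spectral series and `ζ(2)`. -/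

section SpectralSums

/-- The spectral series of a diagonal operator whose nonzero eigenvalues are the numbers
`-(c (j + 1))²`, each of multiplicity `m`. -/
theorem spectral_sum {H ι : Type*} [NormedAddCommGroup H] [InnerProductSpace ℝ H]
    {A : Submodule ℝ (H × H)} (e : HilbertBasis ι ℝ H) {lam : ι → ℝ}
    (hA : ∀ u f, (u, f) ∈ A ↔ ∀ k, ⟪f, e k⟫_ℝ = lam k * ⟪u, e k⟫_ℝ)
    (hlam : Tendsto lam cofinite atBot) {c : ℝ} (hc : 0 < c) (m : ℕ)
    (hrange : Set.range lam \ {0} = Set.range fun j : ℕ => -(c * (j + 1)) ^ 2)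
    (hcard : ∀ j : ℕ, {k | lam k = -(c * (j + 1)) ^ 2}.ncard = m) :
    (∀ l ∈ operatorSpectrum A, 0 < multiplicity A l) ∧
      HasSum (spectralTerm A) (-(m * Real.pi ^ 2 / (6 * c ^ 2))) := by
  have hσ := operatorSpectrum_eq_range e hA hlam
  constructor
  · intro l hl
    rw [hσ] at hl
    obtain ⟨k, hk⟩ := hl
    rw [multiplicity_eq_ncard e hA hlam]
    -- Both `finrank` and `ncard` take the value `0` in the infinite case, so positivity really says
    -- eigenvalue of finite multiplicity.
    have hfin : {k | lam k = l}.Finite := by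
      have := hlam.eventually (eventually_lt_atBot l)
      rw [eventually_cofinite] at this
      exact this.subset fun k (hk : lam k = l) => hk.not_lt
    exact (Set.ncard_pos hfin).2 ⟨k, hk⟩
  · have hmem : ∀ j : ℕ, -(c * (j + 1)) ^ 2 ∈ operatorSpectrum A \ {0} := fun j => by
      rw [hσ, hrange]
      exact ⟨j, rfl⟩
    -- Reindexing the nonzero spectrum by `ℕ` turns the series into `∑ 1 / (j + 1)²`.
    let E : ℕ ≃ ↥(operatorSpectrum A \ {0}) := Equiv.ofBijective
      (fun j => ⟨-(c * (j + 1)) ^ 2, hmem j⟩) (by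
        constructor
        · intro i j hij
          have h1 : -(c * ((i : ℝ) + 1)) ^ 2 = -(c * (j + 1)) ^ 2 := congrArg Subtype.val hij
          have h2 : c * ((i : ℝ) + 1) = c * (j + 1) :=
            (sq_eq_sq₀ (by positivity) (by positivity)).1 (neg_injective h1)
          have h3 := mul_left_cancel₀ hc.ne' h2
          exact_mod_cast add_right_cancel h3
        · rintro ⟨l, hl⟩
          have hl' := hl
          rw [hσ, hrange] at hl'
          obtain ⟨j, hj⟩ := hl'
          exact ⟨j, Subtype.ext hj⟩)
    rw [← E.hasSum_iff]
    have hz : HasSum (fun j : ℕ => 1 / ((j : ℝ) + 1) ^ 2) (Real.pi ^ 2 / 6) := by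
      have := (hasSum_nat_add_iff' (f := fun n : ℕ => 1 / (n : ℝ) ^ 2) 1).2 hasSum_zeta_two
      simpa using this
    have h := hz.mul_left (-(m / c ^ 2))
    have hval : -(m / c ^ 2) * (Real.pi ^ 2 / 6) = -(m * Real.pi ^ 2 / (6 * c ^ 2)) := by
      field_simp
    rw [hval] at h
    refine h.congr_fun fun j => ?_
    change (multiplicity A (-(c * (j + 1)) ^ 2) : ℝ) * (1 / -(c * (j + 1)) ^ 2) = _
    rw [multiplicity_eq_ncard e hA hlam, hcard]
    have : (j : ℝ) + 1 ≠ 0 := by positivity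
    field_simp

theorem intervalLaplacian_spectral_sum :
    (∀ l ∈ operatorSpectrum intervalLaplacian, 0 < multiplicity intervalLaplacian l) ∧
      HasSum (spectralTerm intervalLaplacian) (-(1 / 6)) := by
  obtain ⟨b, hb⟩ := mem_intervalLaplacian_iff
  have hpi := Real.pi_pos
  have hlam : Tendsto (fun k : ℕ => -(Real.pi * k) ^ 2) cofinite atBot := by
    rw [Nat.cofinite_eq_atTop]
    exact tendsto_neg_atTop_atBot.comp ((tendsto_pow_atTop two_ne_zero).comp
      (tendsto_natCast_atTop_atTop.const_mul_atTop hpi))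
  have hinj : ∀ i j : ℕ, -(Real.pi * i) ^ 2 = -(Real.pi * j) ^ 2 → i = j := by
    intro i j h
    have h2 := (sq_eq_sq₀ (by positivity) (by positivity)).1 (neg_injective h)
    exact_mod_cast mul_left_cancel₀ hpi.ne' h2
  have h := spectral_sum b hb hlam hpi 1 ?_ ?_
  · convert h using 3
    field_simp
    norm_num
  · ext l
    constructor
    · rintro ⟨⟨k, rfl⟩, hk⟩
      cases k with
      | zero => simp at hk
      | succ j => exact ⟨j, by push_cast; rfl⟩
    · rintro ⟨j, rfl⟩
      refine ⟨⟨j + 1, by push_cast; rfl⟩, ?_⟩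
      rw [Set.mem_singleton_iff, neg_eq_zero]
      positivity
  · intro j
    rw [Set.ncard_eq_one]
    refine ⟨j + 1, ?_⟩
    ext k
    constructor
    · intro hk
      exact hinj _ _ (Eq.trans hk (by push_cast; rfl))
    · rintro rfl
      change -(Real.pi * ((j + 1 : ℕ) : ℝ)) ^ 2 = _
      push_cast
      rfl

theorem circleLaplacian_spectral_sum :
    (∀ l ∈ operatorSpectrum circleLaplacian, 0 < multiplicity circleLaplacian l) ∧
      HasSum (spectralTerm circleLaplacian) (-(1 / 12)) := by
  obtain ⟨b, hb⟩ := mem_circleLaplacian_iff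
  have hpi := Real.two_pi_pos
  have hsq : ∀ k : ℤ, -(2 * Real.pi * k) ^ 2 = -(2 * Real.pi * (k.natAbs : ℕ)) ^ 2 := by
    intro k
    rw [mul_pow, mul_pow (2 * Real.pi) ((k.natAbs : ℕ) : ℝ), Nat.cast_natAbs, Int.cast_abs, sq_abs]
  have hlam : Tendsto (fun k : ℤ => -(2 * Real.pi * k) ^ 2) cofinite atBot := by
    have habs : Tendsto Int.natAbs cofinite atTop := by
      rw [← Nat.cofinite_eq_atTop]
      refine Tendsto.cofinite_of_finite_preimage_singleton fun n => ?_
      refine (Set.toFinite {(n : ℤ), -(n : ℤ)}).subset fun k (hk : k.natAbs = n) => ?_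
      simp only [Set.mem_insert_iff, Set.mem_singleton_iff]
      omega
    simp only [hsq]
    exact tendsto_neg_atTop_atBot.comp ((tendsto_pow_atTop two_ne_zero).comp
      ((tendsto_natCast_atTop_atTop.comp habs).const_mul_atTop hpi))
  have hinj : ∀ i j : ℕ, -(2 * Real.pi * i) ^ 2 = -(2 * Real.pi * j) ^ 2 → i = j := by
    intro i j h
    have h2 := (sq_eq_sq₀ (by positivity) (by positivity)).1 (neg_injective h)
    exact_mod_cast mul_left_cancel₀ hpi.ne' h2
  have h := spectral_sum b hb hlam hpi 2 ?_ ?_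
  · convert h using 3
    field_simp
    norm_num
  · ext l
    constructor
    · rintro ⟨⟨k, rfl⟩, hk⟩
      simp only [hsq] at hk ⊢
      cases hk' : k.natAbs with
      | zero => simp [hk'] at hk
      | succ j => exact ⟨j, by push_cast; rfl⟩
    · rintro ⟨j, rfl⟩
      refine ⟨⟨j + 1, by push_cast; rfl⟩, ?_⟩
      rw [Set.mem_singleton_iff, neg_eq_zero]
      positivity
  · intro j
    rw [Set.ncard_eq_two]
    -- The two frequencies `± (j + 1)` share the eigenvalue.
    refine ⟨j + 1, -(j + 1), by omega, ?_⟩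
    ext k
    constructor
    · intro hk
      have hk' : -(2 * Real.pi * (k : ℝ)) ^ 2 = -(2 * Real.pi * (j + 1)) ^ 2 := hk
      rw [hsq] at hk'
      have := hinj k.natAbs (j + 1) (hk'.trans (by push_cast; rfl))
      simp only [Set.mem_insert_iff, Set.mem_singleton_iff]
      omega
    · rintro (rfl | rfl)
      · change -(2 * Real.pi * (((j : ℤ) + 1 : ℤ) : ℝ)) ^ 2 = _
        push_cast
        rfl
      · change -(2 * Real.pi * ((-((j : ℤ) + 1) : ℤ) : ℝ)) ^ 2 = _
        push_cast
        ring

end SpectralSums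

/-! ### Kantorovich duality with an explicit potential. -/

section Duality

/-- Dropping the negative part only increases the integral. No sign is required of `g`, because the
dual lower bound for the cost may be negative. -/
theorem ofReal_integral_le_lintegral {α : Type*} [MeasurableSpace α] {μ : Measure α} {g : α → ℝ}
    (hg : Integrable g μ) : ENNReal.ofReal (∫ x, g x ∂μ) ≤ ∫⁻ x, ENNReal.ofReal (g x) ∂μ := by
  rw [integral_eq_lintegral_pos_part_sub_lintegral_neg_part hg]
  refine (ENNReal.ofReal_le_ofReal (sub_le_self _ ENNReal.toReal_nonneg)).trans ?_
  exact ENNReal.ofReal_toReal_le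

variable {D : Type*} [MeasurableSpace D] [PseudoMetricSpace D] {μ ν : Measure D}

/-- A transport map `T` whose cost is `c` is optimal if there is a potential `φ` with
`φ(x) + c(y) - φ(T y) ≤ d(x,y)²`. -/
theorem wassersteinSq_eq_of_potential [IsProbabilityMeasure ν] {T : D → D} (hT : Measurable T)
    (hmap : ν.map T = μ) {φ c : D → ℝ} (hφ : Measurable φ) {C : ℝ} (hφC : ∀ x, |φ x| ≤ C)
    (hc : Integrable c ν) (hlow : ∀ x y, φ x + (c y - φ (T y)) ≤ dist x y ^ 2)
    (hup : ∀ y, dist (T y) y ^ 2 ≤ c y) :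
    wassersteinSq μ ν = ENNReal.ofReal (∫ y, c y ∂ν) := by
  have hprob : IsProbabilityMeasure μ := hmap ▸ Measure.isProbabilityMeasure_map hT.aemeasurable
  have hsq : ∀ x y : D, edist x y ^ 2 = ENNReal.ofReal (dist x y ^ 2) := fun x y => by
    rw [edist_dist, ENNReal.ofReal_pow dist_nonneg]
  have hφμ : Integrable φ μ := Integrable.of_bound hφ.aestronglyMeasurable C
    (Eventually.of_forall hφC)
  have hφT : Integrable (fun y => φ (T y)) ν := Integrable.of_bound
    (hφ.comp hT).aestronglyMeasurable C (Eventually.of_forall fun y => hφC _)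
  refine le_antisymm ?_ ?_
  -- Upper bound: the plan carried by the graph of `T`.
  · have hpair : Measurable fun y => (T y, y) := hT.prodMk measurable_id
    have hplan : ν.map (fun y => (T y, y)) ∈ transportPlans μ ν := by
      constructor
      · rw [Measure.map_map measurable_fst hpair]
        exact hmap
      · rw [Measure.map_map measurable_snd hpair]
        exact Measure.map_id
    refine (iInf₂_le _ hplan).trans ?_
    · refine (lintegral_map_le _ _).trans ?_
      rw [ofReal_integral_eq_lintegral_ofReal hc
        (Eventually.of_forall fun y => (sq_nonneg _).trans (hup y))]
      refine lintegral_mono fun y => ?_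
      rw [hsq]
      exact ENNReal.ofReal_le_ofReal (hup y)
  -- Lower bound: integrate `hlow` against any plan. The marginals are `μ = T_# ν` and `ν`, so the
  -- two `φ` terms cancel and `∫ c dν` remains.
  · refine le_iInf₂ fun S hS => ?_
    have h1 : Integrable (fun p : D × D => φ p.1) S := by
      have := hS.1 ▸ hφμ
      exact this.comp_measurable measurable_fst
    have h2 : Integrable (fun p : D × D => c p.2 - φ (T p.2)) S := by
      have : Integrable (fun y => c y - φ (T y)) (S.map Prod.snd) := by
        rw [hS.2]
        exact hc.sub hφT
      exact this.comp_measurable measurable_snd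
    have e1 : ∫ p : D × D, φ p.1 ∂S = ∫ y, φ (T y) ∂ν := by
      have : ∫ p : D × D, φ p.1 ∂S = ∫ x, φ x ∂(S.map Prod.fst) :=
        (integral_map measurable_fst.aemeasurable hφ.aestronglyMeasurable).symm
      rw [this, hS.1, ← hmap, integral_map hT.aemeasurable hφ.aestronglyMeasurable]
    have e2 : ∫ p : D × D, (c p.2 - φ (T p.2)) ∂S = ∫ y, c y ∂ν - ∫ y, φ (T y) ∂ν := by
      have : ∫ p : D × D, (c p.2 - φ (T p.2)) ∂S =
          ∫ y, (c y - φ (T y)) ∂(S.map Prod.snd) := by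
        refine (integral_map (f := fun y => c y - φ (T y)) measurable_snd.aemeasurable ?_).symm
        rw [hS.2]
        exact (hc.sub hφT).aestronglyMeasurable
      rw [this, hS.2, integral_sub hc hφT]
    have e : ∫ p : D × D, (φ p.1 + (c p.2 - φ (T p.2))) ∂S = ∫ y, c y ∂ν := by
      rw [integral_add h1 h2, e1, e2]
      ring
    rw [← e]
    refine (ofReal_integral_le_lintegral (h1.add h2)).trans (lintegral_mono fun p => ?_)
    rw [hsq]
    exact ENNReal.ofReal_le_ofReal (hlow _ _)

end Duality

/-! ### Cells of length `1/n`, sorting, and the cost of the monotone map. -/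

section Index

/-- The index `i < n` of the cell `[i/n, (i+1)/n]` that contains `s`. -/
def cell (n : ℕ) (s : ℝ) : ℕ := min ⌊n * s⌋₊ (n - 1)

theorem measurable_cell (n : ℕ) : Measurable (cell n) :=
  (Nat.measurable_floor.comp (measurable_const.mul measurable_id)).min measurable_const

theorem cell_lt {n : ℕ} (hn : 1 ≤ n) (s : ℝ) : cell n s < n :=
  lt_of_le_of_lt (min_le_right _ _) (by omega)

theorem cell_le {n : ℕ} {s : ℝ} (hs : 0 ≤ s) : (cell n s : ℝ) ≤ n * s :=
  le_trans (by exact_mod_cast min_le_left _ _) (Nat.floor_le (by positivity))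

/-- The cap at `n - 1` puts `s = 1` in the last cell, which is why the inequality is not strict. -/
theorem le_cell_add_one {n : ℕ} (hn : 1 ≤ n) {s : ℝ} (hs : s ≤ 1) : n * s ≤ cell n s + 1 := by
  rcases min_choice ⌊n * s⌋₊ (n - 1) with h | h
  · rw [cell, h]
    exact (Nat.lt_floor_add_one _).le
  · rw [cell, h, Nat.cast_sub hn]
    have : (0 : ℝ) ≤ n := n.cast_nonneg
    push_cast
    nlinarith

theorem cell_eq {n i : ℕ} (hi : i < n) {s : ℝ} (h1 : i ≤ n * s) (h2 : n * s < i + 1) :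
    cell n s = i := by
  have : ⌊n * s⌋₊ = i := (Nat.floor_eq_iff ((Nat.cast_nonneg i).trans h1)).2 ⟨h1, h2⟩
  rw [cell, this]
  omega

theorem volume_cell {n i : ℕ} (hi : i < n) :
    volume.restrict (Set.Icc (0 : ℝ) 1) {s | cell n s = i} = (n : ℝ≥0∞)⁻¹ := by
  have hn : 1 ≤ n := by omega
  have hn0 : (0 : ℝ) < n := by exact_mod_cast hn
  have hin : (i : ℝ) + 1 ≤ n := by exact_mod_cast hi
  have hlen : ENNReal.ofReal (((i : ℝ) + 1) / n - i / n) = (n : ℝ≥0∞)⁻¹ := by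
    rw [← sub_div, add_sub_cancel_left, one_div, ENNReal.ofReal_inv_of_pos hn0,
      ENNReal.ofReal_natCast]
  have hmeas : MeasurableSet {s | cell n s = i} := measurable_cell n (measurableSet_singleton i)
  rw [Measure.restrict_apply hmeas]
  apply le_antisymm
  · rw [← hlen, ← Real.volume_Icc]
    refine measure_mono fun s ⟨(hs : cell n s = i), hs1⟩ => ?_
    have e1 := cell_le (n := n) hs1.1
    have e2 := le_cell_add_one hn hs1.2
    rw [hs] at e1 e2
    exact ⟨(div_le_iff₀ hn0).2 (by linarith), (le_div_iff₀ hn0).2 (by linarith)⟩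
  · rw [← hlen, ← Real.volume_Ico]
    refine measure_mono fun s hs => ?_
    have e1 := (div_le_iff₀ hn0).1 hs.1
    have e2 := (lt_div_iff₀ hn0).1 hs.2
    refine ⟨cell_eq hi (by linarith) (by linarith), le_trans (by positivity) hs.1,
      hs.2.le.trans ((div_le_one hn0).2 hin)⟩

/-- The cost of sending the cell `a + [i/n, (i+1)/n]` to the point `x i`, for all `i < n`. -/
theorem integral_cell_cost {n : ℕ} (hn : 1 ≤ n) (x : ℕ → ℝ) (a : ℝ) :
    ∫ s in (0 : ℝ)..1, (x (cell n s) - a - s) ^ 2 =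
      (n : ℝ)⁻¹ * ∑ i ∈ Finset.range n, (x i - a) ^ 2 -
        ((n : ℝ) ^ 2)⁻¹ * ∑ i ∈ Finset.range n, (2 * i + 1) * (x i - a) + 1 / 3 := by
  have hn0 : (0 : ℝ) < n := by exact_mod_cast hn
  have hae : ∀ i < n, ∀ᵐ s : ℝ, s ∈ Set.uIoc ((i : ℝ) / n) (((i + 1 : ℕ) : ℝ) / n) →
      (x (cell n s) - a - s) ^ 2 = (x i - a - s) ^ 2 := by
    intro i hi
    -- `uIoc` contains the right endpoint, which for `i + 1 < n` already belongs to the next cell;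
    -- it is a null set.
    have : ∀ᵐ s : ℝ, s ≠ ((i + 1 : ℕ) : ℝ) / n := by simp [ae_iff]
    filter_upwards [this] with s hs hmem
    rw [Set.uIoc_of_le (by gcongr; simp)] at hmem
    have hlt := lt_of_le_of_ne hmem.2 hs
    have e1 := (div_lt_iff₀ hn0).1 hmem.1
    have e2 := (lt_div_iff₀ hn0).1 hlt
    push_cast at e2
    rw [cell_eq hi (by linarith) (by linarith)]
  have hint : ∀ i < n, IntervalIntegrable (fun s => (x (cell n s) - a - s) ^ 2) volume
      ((i : ℝ) / n) (((i + 1 : ℕ) : ℝ) / n) := by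
    intro i hi
    have hc : IntervalIntegrable (fun s => (x i - a - s) ^ 2) volume
      ((i : ℝ) / n) (((i + 1 : ℕ) : ℝ) / n) := Continuous.intervalIntegrable (by fun_prop) _ _
    refine hc.congr_ae ?_
    rw [EventuallyEq, ae_restrict_iff' measurableSet_uIoc]
    filter_upwards [hae i hi] with s hs hmem
    rw [hs hmem]
  have hval : ∀ i < n, ∫ s in ((i : ℝ) / n)..(((i + 1 : ℕ) : ℝ) / n),
      (x (cell n s) - a - s) ^ 2 = (n : ℝ)⁻¹ * (x i - a) ^ 2 -
        ((n : ℝ) ^ 2)⁻¹ * ((2 * i + 1) * (x i - a)) +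
        ((((i + 1 : ℕ) : ℝ) / n) ^ 3 / 3 - ((i : ℝ) / n) ^ 3 / 3) := by
    intro i hi
    rw [intervalIntegral.integral_congr_ae (hae i hi)]
    have hd : ∀ s ∈ Set.uIcc ((i : ℝ) / n) (((i + 1 : ℕ) : ℝ) / n),
        HasDerivAt (fun s => (x i - a) ^ 2 * s - (x i - a) * s ^ 2 + s ^ 3 / 3)
        ((x i - a - s) ^ 2) s := by
      intro s _
      refine ((((hasDerivAt_id s).const_mul _).sub ((hasDerivAt_pow 2 s).const_mul _)).add
        ((hasDerivAt_pow 3 s).div_const 3)).congr_deriv ?_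
      norm_num
      ring
    rw [intervalIntegral.integral_eq_sub_of_hasDerivAt hd
      (Continuous.intervalIntegrable (by fun_prop) _ _)]
    push_cast
    field_simp
    ring
  -- Summing over the cells, the cubes telescope to `1/3`.
  have hsum := intervalIntegral.sum_integral_adjacent_intervals
    (f := fun s => (x (cell n s) - a - s) ^ 2) (μ := volume) (a := fun i : ℕ => (i : ℝ) / n)
    (n := n) hint
  simp only [Nat.cast_zero, zero_div, div_self hn0.ne'] at hsum
  rw [← hsum, Finset.sum_congr rfl fun i hi => hval i (Finset.mem_range.1 hi),
    Finset.sum_add_distrib, Finset.sum_sub_distrib, ← Finset.mul_sum, ← Finset.mul_sum,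
    Finset.sum_range_sub fun i : ℕ => ((i : ℝ) / n) ^ 3 / 3]
  simp [div_self hn0.ne']

variable {D : Type*} [MeasurableSpace D] [PseudoMetricSpace D] {ν : Measure D}

/-- The Wasserstein distance to an empirical measure, when the optimal map sends the cell
`a + [i/n, (i+1)/n]` to the point `z i` with coordinate `x i`, for all `i < n`. -/
theorem wassersteinSq_empiricalMeasure_eq [IsProbabilityMeasure ν] {u : D → ℝ}
    (hu : MeasurePreserving u ν (volume.restrict (Set.Icc 0 1)))
    {n : ℕ} (hn : 1 ≤ n) (z : ℕ → D) (x : ℕ → ℝ) (a : ℝ) {φ : D → ℝ} (hφ : Measurable φ)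
    {C : ℝ} (hφC : ∀ y, |φ y| ≤ C)
    (hlow : ∀ w y, φ w + ((x (cell n (u y)) - a - u y) ^ 2 - φ (z (cell n (u y)))) ≤ dist w y ^ 2)
    (hup : ∀ y, dist (z (cell n (u y))) y ^ 2 ≤ (x (cell n (u y)) - a - u y) ^ 2) :
    (wassersteinSq (empiricalMeasure z n) ν).toReal =
      (n : ℝ)⁻¹ * ∑ i ∈ Finset.range n, (x i - a) ^ 2 -
        ((n : ℝ) ^ 2)⁻¹ * ∑ i ∈ Finset.range n, (2 * i + 1) * (x i - a) + 1 / 3 := by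
  have hcell : Measurable fun y => cell n (u y) := (measurable_cell n).comp hu.measurable
  have hT : Measurable fun y => z (cell n (u y)) := measurable_from_nat.comp hcell
  have hcm : Measurable fun s : ℝ => (x (cell n s) - a - s) ^ 2 :=
    (((measurable_from_nat.comp (measurable_cell n)).sub measurable_const).sub
      measurable_id).pow_const 2
  have hmap : ν.map (fun y => z (cell n (u y))) = empiricalMeasure z n := by
    -- The cell index is uniform on `range n`; pushing it forward by `z` gives the empirical
    -- measure.
    have h1 : ν.map (fun y => cell n (u y)) =
        (n : ℝ≥0∞)⁻¹ • ∑ i ∈ Finset.range n, Measure.dirac i := by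
      refine Measure.ext_of_singleton fun i => ?_
      rw [Measure.map_apply hcell (measurableSet_singleton i)]
      have h2 : ν ((fun y => cell n (u y)) ⁻¹' {i}) =
          volume.restrict (Set.Icc (0 : ℝ) 1) {s | cell n s = i} := by
        rw [← hu.map_eq]
        exact (Measure.map_apply hu.measurable
          (measurable_cell n (measurableSet_singleton i))).symm
      rw [h2]
      by_cases hi : i < n
      · rw [volume_cell hi]
        simp [Set.indicator_apply, hi]
      · have : {s | cell n s = i} = ∅ := by
          ext s
          have := cell_lt hn s
          simp only [Set.mem_ofPred_eq, Set.mem_empty_iff_false, iff_false]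
          omega
        rw [this, measure_empty]
        simp [Set.indicator_apply, hi]
    have h3 : ν.map (fun y => z (cell n (u y))) = (ν.map fun y => cell n (u y)).map z :=
      (Measure.map_map measurable_from_nat hcell).symm
    rw [h3, h1, empiricalMeasure, Measure.map_smul, ← Measure.mapₗ_apply_of_measurable
      measurable_from_nat, map_sum]
    simp only [Measure.mapₗ_apply_of_measurable (measurable_from_nat (f := z)),
      Measure.map_dirac' (measurable_from_nat (f := z))]
  have hci : Integrable (fun s : ℝ => (x (cell n s) - a - s) ^ 2)
      (volume.restrict (Set.Icc 0 1)) := by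
    refine Integrable.of_bound hcm.aestronglyMeasurable
      ((∑ i ∈ Finset.range n, |x i| + |a| + 1) ^ 2) ?_
    rw [ae_restrict_iff' measurableSet_Icc]
    refine Eventually.of_forall fun s hs => ?_
    rw [norm_pow, Real.norm_eq_abs]
    have hx : |x (cell n s)| ≤ ∑ i ∈ Finset.range n, |x i| :=
      Finset.single_le_sum (f := fun i => |x i|) (fun i _ => abs_nonneg _)
        (Finset.mem_range.2 (cell_lt hn s))
    have hs1 : |s| ≤ 1 := abs_le.2 ⟨by linarith [hs.1], hs.2⟩
    have := abs_sub (x (cell n s) - a) s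
    have := abs_sub (x (cell n s)) a
    gcongr
    linarith
  have hcν : Integrable (fun y => (x (cell n (u y)) - a - u y) ^ 2) ν :=
    hu.integrable_comp_of_integrable hci
  rw [wassersteinSq_eq_of_potential hT hmap hφ hφC hcν hlow hup,
    ENNReal.toReal_ofReal (integral_nonneg fun y => sq_nonneg _), ← integral_cell_cost hn,
    intervalIntegral.integral_of_le zero_le_one, ← integral_Icc_eq_integral_Ioc, ← hu.map_eq,
    integral_map hu.aemeasurable hcm.aestronglyMeasurable]

theorem empiricalMeasure_comp {D : Type*} [MeasurableSpace D] (X : ℕ → D) {n : ℕ} {τ : ℕ → ℕ}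
    (hτ : Set.BijOn τ (Finset.range n) (Finset.range n)) :
    empiricalMeasure (fun i => X (τ i)) n = empiricalMeasure X n := by
  rw [empiricalMeasure, empiricalMeasure]
  congr 1
  exact Finset.sum_nbij τ hτ.mapsTo hτ.injOn hτ.surjOn fun i _ => rfl

/-- The positions of a sequence can be sorted. -/
theorem exists_sorting (x : ℕ → ℝ) (n : ℕ) : ∃ τ : ℕ → ℕ,
    (∀ i < n, ∀ j < n, i ≤ j → x (τ i) ≤ x (τ j)) ∧
      Set.BijOn τ (Finset.range n) (Finset.range n) := by
  set f : Fin n → ℝ := fun i => x i with hf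
  have hmono := Tuple.monotone_sort f
  refine ⟨fun i => if h : i < n then Tuple.sort f ⟨i, h⟩ else i, fun i hi j hj hij => ?_, ?_, ?_,
    ?_⟩
  · simp only [hi, hj, dif_pos]
    exact hmono (a := ⟨i, hi⟩) (b := ⟨j, hj⟩) hij
  · intro i hi
    have hi' : i < n := by simpa using hi
    simp [hi']
  · intro i hi j hj hij
    have hi' : i < n := by simpa using hi
    have hj' : j < n := by simpa using hj
    simp only [hi', hj', dif_pos] at hij
    simpa using (Tuple.sort f).injective (Fin.ext hij)
  · intro j hj
    have hj' : j < n := by simpa using hj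
    obtain ⟨⟨i, hi⟩, hij⟩ := (Tuple.sort f).surjective ⟨j, hj'⟩
    refine ⟨i, by simpa using hi, ?_⟩
    simp [hi, hij]

/-- The `i`-th sorted point is the maximum for the `2i + 1` ordered pairs whose larger index is `i`.
The right side involves order statistics, whereas the left is symmetric and so independent of the
sorting. -/
theorem sum_sum_max_of_sorted (x : ℕ → ℝ) (n : ℕ) (hx : ∀ i < n, ∀ j < n, i ≤ j → x i ≤ x j) :
    ∑ i ∈ Finset.range n, ∑ j ∈ Finset.range n, max (x i) (x j) =
      ∑ i ∈ Finset.range n, (2 * i + 1) * x i := by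
  induction n with
  | zero => simp
  | succ n ih =>
    have h : ∀ i ∈ Finset.range n, max (x i) (x n) = x n := fun i hi =>
      max_eq_right (hx i (by simp at hi; omega) n (by omega) (by simp at hi; omega))
    have h' : ∀ i ∈ Finset.range n, max (x n) (x i) = x n := fun i hi => by
      rw [max_comm, h i hi]
    simp only [Finset.sum_range_succ, Finset.sum_add_distrib, Finset.sum_congr rfl h,
      Finset.sum_congr rfl h', max_self]
    rw [ih fun i hi j hj => hx i (by omega) j (by omega)]
    simp
    ring

/-- The weight of the index `j` below `s`: the part of the cell `[j/n, (j+1)/n]` to the left of `s`,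
in units of the cell length. -/
def cellWeight (n : ℕ) (s : ℝ) (j : ℕ) : ℝ :=
  if j < cell n s then 1 else if j = cell n s then n * s - cell n s else 0

/-- The cells before `s` count fully and its own cell counts `n * s - cell n s`. -/
theorem sum_cellWeight {n : ℕ} (hn : 1 ≤ n) (s : ℝ) :
    ∑ j ∈ Finset.range n, cellWeight n s j = n * s := by
  have hlt := cell_lt hn s
  have h1 : ∀ j, cellWeight n s j = (if j ∈ Finset.range (cell n s) then 1 else 0) +
      (if j = cell n s then n * s - cell n s else 0) := fun j => by
    simp only [cellWeight, Finset.mem_range]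
    split_ifs with h h' h'
    · omega
    · simp
    · simp
    · simp
  have h2 : (Finset.range n).filter (fun j => j ∈ Finset.range (cell n s)) =
      Finset.range (cell n s) := by
    ext j
    simp only [Finset.mem_filter, Finset.mem_range]
    omega
  simp only [h1, Finset.sum_add_distrib]
  rw [← Finset.sum_filter, h2, Finset.sum_ite_eq' , if_pos (Finset.mem_range.2 hlt)]
  simp

end Index

/-! ### The exact cost on the interval. -/

section IntervalTransport

/-- The weight is a subgradient of the convex function `t ↦ max (t - x j) 0` at the sorted point `x
(cell n s)`: slope `1` for points before it, `0` for points after it, and any slope in `[0,1]` at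
the kink. The choice at the kink makes the average slope equal to `s`. -/
theorem cellWeight_mul_le_posPart {n : ℕ} (hn : 1 ≤ n) {x : ℕ → ℝ}
    (hx : ∀ i < n, ∀ j < n, i ≤ j → x i ≤ x j) {s : ℝ} (hs : s ∈ Set.Icc (0 : ℝ) 1) (w : ℝ)
    {j : ℕ} (hj : j < n) :
    cellWeight n s j * (w - x (cell n s)) ≤ max (w - x j) 0 - max (x (cell n s) - x j) 0 := by
  have hlt := cell_lt hn s
  have e1 := cell_le (n := n) hs.1
  have e2 := le_cell_add_one hn hs.2
  unfold cellWeight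
  split_ifs with h h'
  · have := hx j hj _ hlt h.le
    rw [max_eq_left (by linarith : 0 ≤ x (cell n s) - x j)]
    linarith [le_max_left (w - x j) 0]
  · rw [← h', sub_self, max_self, sub_zero]
    subst h'
    rcases le_total (w - x (cell n s)) 0 with hw | hw
    · rw [max_eq_right hw]
      exact mul_nonpos_of_nonneg_of_nonpos (by linarith) hw
    · rw [max_eq_left hw]
      nlinarith
  · have := hx _ hlt j hj (by omega)
    rw [max_eq_right (by linarith : x (cell n s) - x j ≤ 0), zero_mul, sub_zero]
    exact le_max_right _ _

/-- The Wasserstein distance between an empirical measure on the unit interval and the volume. -/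
theorem wassersteinSq_unitInterval (X : ℕ → unitInterval) {n : ℕ} (hn : 1 ≤ n) :
    (wassersteinSq (empiricalMeasure X n) volume).toReal =
      (n : ℝ)⁻¹ * ∑ i ∈ Finset.range n, (X i : ℝ) ^ 2 -
        ((n : ℝ) ^ 2)⁻¹ * ∑ i ∈ Finset.range n, ∑ j ∈ Finset.range n, max (X i : ℝ) (X j) +
        1 / 3 := by
  obtain ⟨τ, hmono, hτ⟩ := exists_sorting (fun i => (X i : ℝ)) n
  have hn0 : (0 : ℝ) < n := by exact_mod_cast hn
  have hsum : ∀ f : unitInterval → ℝ, ∑ i ∈ Finset.range n, f (X (τ i)) =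
      ∑ i ∈ Finset.range n, f (X i) := fun f =>
    Finset.sum_nbij τ hτ.mapsTo hτ.injOn hτ.surjOn fun i _ => rfl
  set x : ℕ → ℝ := fun i => X (τ i) with hx
  -- With `ψ w = (1/n) ∑ max (w - x j) 0`, the primitive of the empirical distribution function, the
  -- potential is `w² - 2 ψ w`.
  let φ : unitInterval → ℝ := fun w =>
    (w : ℝ) ^ 2 - 2 * (n : ℝ)⁻¹ * ∑ j ∈ Finset.range n, max (w - x j) 0
  have hφc : Continuous φ := by fun_prop
  obtain ⟨C, hC⟩ := isCompact_univ.exists_bound_of_continuousOn hφc.continuousOn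
  have key := wassersteinSq_empiricalMeasure_eq (ν := (volume : Measure unitInterval))
    unitInterval.measurePreserving_coe hn (fun i => X (τ i)) x 0 (φ := φ) hφc.measurable (C := C)
    (fun y => hC y trivial) ?_ ?_
  · rw [empiricalMeasure_comp X hτ] at key
    simp only [sub_zero] at key
    rw [key, ← sum_sum_max_of_sorted x n hmono, hsum fun w => (w : ℝ) ^ 2]
    congr 3
    rw [hsum fun w => ∑ j ∈ Finset.range n, max (w : ℝ) (X (τ j))]
    exact Finset.sum_congr rfl fun i _ => hsum fun w => max (X i : ℝ) w
  · intro w y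
    -- Averaging the subgradient inequalities gives `s (w - x) ≤ ψ w - ψ x` for `x = x (cell n s)`,
    -- which is `φ w - φ x ≤ (w - s)² - (x - s)²`.
    have h := Finset.sum_le_sum fun j (hj : j ∈ Finset.range n) =>
      cellWeight_mul_le_posPart hn hmono y.2 w (Finset.mem_range.1 hj)
    rw [← Finset.sum_mul, sum_cellWeight hn, Finset.sum_sub_distrib] at h
    have h' := mul_le_mul_of_nonneg_left h (inv_nonneg.2 hn0.le)
    rw [← mul_assoc, ← mul_assoc, inv_mul_cancel₀ hn0.ne', one_mul] at h'
    rw [Subtype.dist_eq, Real.dist_eq, sq_abs]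
    simp only [φ, sub_zero]
    have e : (X (τ (cell n y)) : ℝ) = x (cell n y) := rfl
    rw [e]
    linarith
  · intro y
    rw [Subtype.dist_eq, Real.dist_eq, sq_abs, sub_zero]

end IntervalTransport

/-! ### The exact cost on the circle. -/

section CircleTransport

/-- The coordinate in `[0,1)` of a point of the circle. -/
def coord (w : UnitAddCircle) : ℝ := (AddCircle.equivIco 1 0 w : ℝ)

theorem coe_coord (w : UnitAddCircle) : (coord w : UnitAddCircle) = w :=
  (AddCircle.equivIco 1 0).symm_apply_apply w

theorem coord_mem (w : UnitAddCircle) : coord w ∈ Set.Ico (0 : ℝ) 1 := by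
  have := (AddCircle.equivIco 1 0 w).2
  exact ⟨this.1, this.2.trans_eq (zero_add 1)⟩

theorem coord_coe (s : ℝ) : coord (s : UnitAddCircle) = Int.fract s := by
  have : coord (s : UnitAddCircle) = toIcoMod one_pos 0 s := rfl
  rw [this, toIcoMod_zero_one]

theorem measurable_coord : Measurable coord :=
  measurable_subtype_coe.comp (AddCircle.measurableEquivIco 1 0).measurable

/-- Rounding selects the lift nearest to `y`. An inequality valid for all real lifts thereby
descends to the circle distance. -/
theorem exists_lift (w : UnitAddCircle) (y : ℝ) :
    ∃ t : ℝ, (t : UnitAddCircle) = w ∧ |t - y| = dist w (y : UnitAddCircle) := by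
  refine ⟨coord w - round (coord w - y), ?_, ?_⟩
  · rw [AddCircle.coe_sub, coe_coord, sub_eq_self]
    exact (AddCircle.coe_eq_zero_iff 1).2 ⟨round (coord w - y), by simp⟩
  · rw [dist_eq_norm]
    conv_rhs => rw [← coe_coord w, ← AddCircle.coe_sub, UnitAddCircle.norm_eq]
    congr 1
    ring

theorem dist_coe_le (s t : ℝ) : dist (s : UnitAddCircle) (t : UnitAddCircle) ≤ |s - t| := by
  rw [dist_eq_norm, ← AddCircle.coe_sub, UnitAddCircle.norm_eq]
  simpa using round_le (s - t) 0

/-- The second Bernoulli polynomial, made periodic. -/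
def bernoulliTwo (u : ℝ) : ℝ := Int.fract u ^ 2 - Int.fract u + 1 / 6

/-- The periodic function is the lower envelope of the integer translates of its parabola: shifting
`f = fract u` by an integer `m` changes the value by `m (2 f + m - 1) ≥ 0`. -/
theorem bernoulliTwo_le (u : ℝ) (k : ℤ) : bernoulliTwo u ≤ (u - k) ^ 2 - (u - k) + 1 / 6 := by
  unfold bernoulliTwo
  have h0 := Int.fract_nonneg u
  have h1 := Int.fract_lt_one u
  set m : ℤ := ⌊u⌋ - k with hm
  have hu : u - k = Int.fract u + m := by
    rw [hm]
    push_cast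
    linarith [Int.floor_add_fract u]
  rw [hu]
  rcases le_or_gt m 0 with hm0 | hm0
  · rcases eq_or_lt_of_le hm0 with h | h
    · rw [h]
      simp
    · have : (m : ℝ) ≤ -1 := by exact_mod_cast (by omega : m ≤ -1)
      nlinarith
  · have : (1 : ℝ) ≤ m := by exact_mod_cast hm0
    nlinarith

/-- The right end `u - k = 1` is allowed because consecutive parabolas meet there. Tied sample
points can then be treated with either translate. -/
theorem bernoulliTwo_eq {u : ℝ} {k : ℤ} (h0 : 0 ≤ u - k) (h1 : u - k ≤ 1) :
    bernoulliTwo u = (u - k) ^ 2 - (u - k) + 1 / 6 := by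
  rcases eq_or_lt_of_le h1 with h | h
  · have : u = ((k + 1 : ℤ) : ℝ) := by
      push_cast
      linarith
    rw [bernoulliTwo, h, this, Int.fract_intCast]
    norm_num
  · have : Int.fract u = u - k := Int.fract_eq_iff.2 ⟨h0, h, k, by ring⟩
    rw [bernoulliTwo, this]

/-- Bound the first value by the translate `0` or `-1` of the parabola, choosing the one that is
exact at `x (cell n s) - x j`: `0` if `x j` is the smaller point, `-1` if it is the larger. For `j =
cell n s` both are exact, and a convex combination gives the intermediate weight. -/
theorem bernoulliTwo_sub_le_cellWeight {n : ℕ} (hn : 1 ≤ n) {x : ℕ → ℝ}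
    (hx : ∀ i < n, ∀ j < n, i ≤ j → x i ≤ x j) (hx01 : ∀ i, x i ∈ Set.Ico (0 : ℝ) 1) {s : ℝ}
    (hs : s ∈ Set.Icc (0 : ℝ) 1) (w : ℝ) {j : ℕ} (hj : j < n) :
    bernoulliTwo (w - x j) - bernoulliTwo (x (cell n s) - x j) ≤
      (w - x j) ^ 2 - (x (cell n s) - x j) ^ 2 -
        (2 * cellWeight n s j - 1) * (w - x (cell n s)) := by
  have hlt := cell_lt hn s
  have e1 := cell_le (n := n) hs.1
  have e2 := le_cell_add_one hn hs.2
  have hj01 := hx01 j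
  have hi01 := hx01 (cell n s)
  have b0 := bernoulliTwo_le (w - x j) 0
  have b1 := bernoulliTwo_le (w - x j) (-1)
  push_cast at b0 b1
  have hlow : x j ≤ x (cell n s) → bernoulliTwo (w - x j) - bernoulliTwo (x (cell n s) - x j) ≤
      (w - x j) ^ 2 - (x (cell n s) - x j) ^ 2 - (w - x (cell n s)) := by
    intro h
    rw [bernoulliTwo_eq (u := x (cell n s) - x j) (k := 0) (by push_cast; linarith)
      (by push_cast; linarith [hj01.1, hi01.2])]
    push_cast
    linarith
  have hhigh : x (cell n s) ≤ x j → bernoulliTwo (w - x j) - bernoulliTwo (x (cell n s) - x j) ≤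
      (w - x j) ^ 2 - (x (cell n s) - x j) ^ 2 + (w - x (cell n s)) := by
    intro h
    rw [bernoulliTwo_eq (u := x (cell n s) - x j) (k := -1)
      (by push_cast; linarith [hj01.2, hi01.1]) (by push_cast; linarith)]
    push_cast
    linarith
  unfold cellWeight
  split_ifs with h h'
  · have := hlow (hx j hj _ hlt h.le)
    linarith
  · subst h'
    have h1 := mul_le_mul_of_nonneg_left (hlow le_rfl)
      (by linarith : (0 : ℝ) ≤ n * s - cell n s)
    have h2 := mul_le_mul_of_nonneg_left (hhigh le_rfl)
      (by linarith : (0 : ℝ) ≤ 1 - (n * s - cell n s))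
    linarith
  · have := hhigh (hx _ hlt j hj (by omega))
    linarith

/-- The coordinate in `(0,1]` of a point of the circle, measured from the origin `a`. -/
def coordFrom (a : ℝ) (y : UnitAddCircle) : ℝ := (AddCircle.equivIoc 1 a y : ℝ) - a

theorem coe_coordFrom (a : ℝ) (y : UnitAddCircle) : ((a + coordFrom a y : ℝ) : UnitAddCircle) = y := by
  rw [coordFrom, add_sub_cancel]
  exact (AddCircle.equivIoc 1 a).symm_apply_apply y

theorem coordFrom_mem (a : ℝ) (y : UnitAddCircle) : coordFrom a y ∈ Set.Icc (0 : ℝ) 1 := by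
  have := (AddCircle.equivIoc 1 a y).2
  exact ⟨sub_nonneg.2 this.1.le, by unfold coordFrom; linarith [this.2]⟩

theorem measurePreserving_coordFrom (a : ℝ) :
    MeasurePreserving (coordFrom a) volume (volume.restrict (Set.Icc 0 1)) := by
  have hm : Measurable (coordFrom a) :=
    (measurable_subtype_coe.comp (AddCircle.measurableEquivIoc 1 a).measurable).sub_const a
  refine ⟨hm, ?_⟩
  rw [← (UnitAddCircle.measurePreserving_mk a).map_eq,
    Measure.map_map hm (UnitAddCircle.measurePreserving_mk a).measurable]
  have hcongr : (coordFrom a ∘ fun t : ℝ => (t : UnitAddCircle)) =ᵐ[volume.restrict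
      (Set.Ioc a (a + 1))] fun t => t - a := by
    rw [EventuallyEq, ae_restrict_iff' measurableSet_Ioc]
    refine Eventually.of_forall fun t ht => ?_
    simp only [Function.comp, coordFrom]
    rw [AddCircle.equivIoc_coe_eq ht]
  rw [Measure.map_congr hcongr, Measure.restrict_congr_set Ioc_ae_eq_Icc.symm]
  have := (measurePreserving_sub_right volume a).restrict_preimage
    (measurableSet_Ioc (a := (0 : ℝ)) (b := 1))
  simpa [add_comm] using this.map_eq

/-- The Wasserstein distance between an empirical measure on the circle and the volume. -/
theorem wassersteinSq_circle (X : ℕ → UnitAddCircle) {n : ℕ} (hn : 1 ≤ n) :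
    (wassersteinSq (empiricalMeasure X n) volume).toReal =
      (n : ℝ)⁻¹ * ∑ i ∈ Finset.range n, coord (X i) ^ 2 -
        ((n : ℝ)⁻¹ * ∑ i ∈ Finset.range n, coord (X i)) ^ 2 +
        (n : ℝ)⁻¹ * ∑ i ∈ Finset.range n, coord (X i) -
        ((n : ℝ) ^ 2)⁻¹ * ∑ i ∈ Finset.range n, ∑ j ∈ Finset.range n,
          max (coord (X i)) (coord (X j)) + 1 / 12 := by
  obtain ⟨τ, hmono, hτ⟩ := exists_sorting (fun i => coord (X i)) n
  have hn0 : (0 : ℝ) < n := by exact_mod_cast hn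
  have hsum : ∀ f : UnitAddCircle → ℝ, ∑ i ∈ Finset.range n, f (X (τ i)) =
      ∑ i ∈ Finset.range n, f (X i) := fun f =>
    Finset.sum_nbij τ hτ.mapsTo hτ.injOn hτ.surjOn fun i _ => rfl
  set x : ℕ → ℝ := fun i => coord (X (τ i)) with hx
  set m : ℝ := (n : ℝ)⁻¹ * ∑ i ∈ Finset.range n, x i with hm
  have hmsum : ∑ i ∈ Finset.range n, x i = n * m := by rw [hm, mul_inv_cancel_left₀ hn0.ne']
  -- Both the origin that minimises the cost over rotations and the only one for which the linear
  -- terms in `hmain` match.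
  set a : ℝ := m - 1 / 2 with ha
  let β : UnitAddCircle → ℝ := fun w => coord w ^ 2 - coord w + 1 / 6
  have hβ : ∀ s : ℝ, β (s : UnitAddCircle) = bernoulliTwo s := fun s => by
    simp only [β, coord_coe, bernoulliTwo]
  have hβm : Measurable β := ((measurable_coord.pow_const 2).sub measurable_coord).add_const _
  have hβ1 : ∀ w, |β w| ≤ 1 := fun w => by
    have := coord_mem w
    rw [abs_le]
    constructor <;> simp only [β] <;> nlinarith [this.1, this.2]
  let φ : UnitAddCircle → ℝ := fun w => (n : ℝ)⁻¹ * ∑ j ∈ Finset.range n, β (w - X (τ j))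
  have hφm : Measurable φ := (Finset.measurable_sum _ fun j _ =>
    hβm.comp (measurable_id.sub_const _)).const_mul _
  have hφ1 : ∀ w, |φ w| ≤ 1 := fun w => by
    simp only [φ]
    rw [abs_mul, abs_of_pos (inv_pos.2 hn0), inv_mul_le_iff₀ hn0, mul_one]
    refine (Finset.abs_sum_le_sum_abs _ _).trans ?_
    refine (Finset.sum_le_sum fun j _ => hβ1 _).trans ?_
    simp
  have hφ : ∀ t : ℝ, φ (t : UnitAddCircle) =
      (n : ℝ)⁻¹ * ∑ j ∈ Finset.range n, bernoulliTwo (t - x j) := fun t => by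
    simp only [φ]
    congr 1
    refine Finset.sum_congr rfl fun j _ => ?_
    rw [← hβ, AddCircle.coe_sub, hx, coe_coord]
  have hmain : ∀ (t s : ℝ), s ∈ Set.Icc (0 : ℝ) 1 →
      φ (t : UnitAddCircle) - φ (x (cell n s) : UnitAddCircle) ≤
        (t - (a + s)) ^ 2 - (x (cell n s) - a - s) ^ 2 := by
    intro t s hs
    have h := Finset.sum_le_sum fun j (hj : j ∈ Finset.range n) =>
      bernoulliTwo_sub_le_cellWeight hn hmono (fun i => coord_mem _) hs t (Finset.mem_range.1 hj)
    have h' := mul_le_mul_of_nonneg_left h (inv_nonneg.2 hn0.le)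
    rw [Finset.sum_sub_distrib, mul_sub, ← hφ, ← hφ] at h'
    refine h'.trans (le_of_eq ?_)
    -- After averaging, the second factor becomes `t + x + 1 - 2 m - 2 s = (t - a - s) + (x - a -
    -- s)`, where `x = x (cell n s)`: a difference of squares.
    have e : ∀ j, (t - x j) ^ 2 - (x (cell n s) - x j) ^ 2 -
        (2 * cellWeight n s j - 1) * (t - x (cell n s)) =
        (t - x (cell n s)) * ((t + x (cell n s) + 1) - 2 * x j - 2 * cellWeight n s j) :=
      fun j => by ring
    change (n : ℝ)⁻¹ * ∑ j ∈ Finset.range n, ((t - x j) ^ 2 - (x (cell n s) - x j) ^ 2 -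
        (2 * cellWeight n s j - 1) * (t - x (cell n s))) = _
    simp only [e]
    rw [← Finset.mul_sum, Finset.sum_sub_distrib, Finset.sum_sub_distrib, ← Finset.mul_sum,
      ← Finset.mul_sum, sum_cellWeight hn, hmsum, Finset.sum_const, Finset.card_range, nsmul_eq_mul,
      ha]
    field_simp
    ring
  have hprob : IsProbabilityMeasure (volume : Measure UnitAddCircle) :=
    ⟨UnitAddCircle.measure_univ⟩
  have key := wassersteinSq_empiricalMeasure_eq (measurePreserving_coordFrom a) hn
    (fun i => X (τ i)) x a hφm hφ1 ?_ ?_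
  · rw [empiricalMeasure_comp X hτ] at key
    rw [key]
    have s1 : ∑ i ∈ Finset.range n, (x i - a) ^ 2 =
        ∑ i ∈ Finset.range n, coord (X i) ^ 2 - 2 * a * (n * m) + n * a ^ 2 := by
      have e : ∀ i, (x i - a) ^ 2 = x i ^ 2 - 2 * a * x i + a ^ 2 := fun i => by ring
      simp only [e]
      rw [Finset.sum_add_distrib, Finset.sum_sub_distrib, ← Finset.mul_sum, hmsum,
        ← hsum fun w => coord w ^ 2]
      simp [hx]
    have s2 : ∑ i ∈ Finset.range n, (2 * (i : ℝ) + 1) * (x i - a) =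
        ∑ i ∈ Finset.range n, ∑ j ∈ Finset.range n, max (coord (X i)) (coord (X j)) -
          n ^ 2 * a := by
      have e : ∀ k : ℕ, ∑ i ∈ Finset.range k, (2 * (i : ℝ) + 1) = k ^ 2 := fun k => by
        induction k with
        | zero => simp
        | succ k ih =>
          rw [Finset.sum_range_succ, ih]
          push_cast
          ring
      simp only [mul_sub]
      rw [Finset.sum_sub_distrib, ← Finset.sum_mul, e, ← sum_sum_max_of_sorted x n hmono,
        ← hsum fun w => ∑ j ∈ Finset.range n, max (coord w) (coord (X j))]
      congr 1
      exact Finset.sum_congr rfl fun i _ => hsum fun w => max (x i) (coord w)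
    have s3 : (n : ℝ)⁻¹ * ∑ i ∈ Finset.range n, coord (X i) = m := by
      rw [hm, ← hsum coord]
    rw [s1, s2, s3, ha]
    field_simp
    ring
  · intro w y
    -- The real inequality `hmain` is used at the lift of `w` nearest to `a + coordFrom a y`.
    obtain ⟨t, ht, hty⟩ := exists_lift w (a + coordFrom a y)
    have := hmain t _ (coordFrom_mem a y)
    rw [coe_coordFrom] at hty
    rw [← hty, sq_abs, ← ht]
    have e : (x (cell n (coordFrom a y)) : UnitAddCircle) = X (τ (cell n (coordFrom a y))) :=
      coe_coord _
    rw [e] at this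
    linarith
  · intro y
    set s := coordFrom a y with hs
    have h := dist_coe_le (x (cell n s)) (a + s)
    have e : (x (cell n s) : UnitAddCircle) = X (τ (cell n s)) := coe_coord _
    rw [e, hs, coe_coordFrom, ← hs, ← sub_sub] at h
    rw [← sq_abs (x (cell n s) - a - s)]
    gcongr

end CircleTransport

/-! ### Moments of uniform variables and the expected cost. -/

section Expectation

theorem setIntegral_unit (f : ℝ → ℝ) :
    ∫ x in Set.Icc (0 : ℝ) 1, f x = ∫ x in (0 : ℝ)..1, f x := by
  rw [intervalIntegral.integral_of_le zero_le_one, integral_Icc_eq_integral_Ioc]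

theorem integral_max {a : ℝ} (ha : a ∈ Set.Icc (0 : ℝ) 1) :
    ∫ b in (0 : ℝ)..1, max a b = (1 + a ^ 2) / 2 := by
  rw [← intervalIntegral.integral_add_adjacent_intervals (b := a)
    (Continuous.intervalIntegrable (by fun_prop) _ _)
    (Continuous.intervalIntegrable (by fun_prop) _ _)]
  have h1 : ∫ b in (0 : ℝ)..a, max a b = ∫ b in (0 : ℝ)..a, a := by
    refine intervalIntegral.integral_congr fun b hb => ?_
    rw [Set.uIcc_of_le ha.1] at hb
    exact max_eq_left hb.2
  have h2 : ∫ b in a..1, max a b = ∫ b in a..1, b := by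
    refine intervalIntegral.integral_congr fun b hb => ?_
    rw [Set.uIcc_of_le ha.2] at hb
    exact max_eq_right hb.1
  rw [h1, h2, intervalIntegral.integral_const, integral_id]
  simp
  ring

theorem integral_integral_max :
    ∫ a in Set.Icc (0 : ℝ) 1, ∫ b in Set.Icc (0 : ℝ) 1, max a b = 2 / 3 := by
  have h : ∀ a ∈ Set.Icc (0 : ℝ) 1, ∫ b in Set.Icc (0 : ℝ) 1, max a b = (1 + a ^ 2) / 2 :=
    fun a ha => by rw [setIntegral_unit, integral_max ha]
  rw [setIntegral_congr_fun measurableSet_Icc h, setIntegral_unit,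
    intervalIntegral.integral_div, intervalIntegral.integral_add
    (Continuous.intervalIntegrable (by fun_prop) _ _)
    (Continuous.intervalIntegrable (by fun_prop) _ _), integral_pow]
  norm_num

theorem sum_sum_ite_eq (n : ℕ) (α β : ℝ) :
    ∑ i ∈ Finset.range n, ∑ j ∈ Finset.range n, (if i = j then α else β) =
      n * α + n * (n - 1) * β := by
  have h : ∀ i ∈ Finset.range n, ∑ j ∈ Finset.range n, (if i = j then α else β) =
      α + (n - 1) * β := by
    intro i hi
    have : ∀ j, (if i = j then α else β) = (if i = j then α - β else 0) + β := fun j => by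
      split_ifs <;> ring
    simp only [this]
    rw [Finset.sum_add_distrib, Finset.sum_ite_eq, if_pos hi, Finset.sum_const,
      Finset.card_range, nsmul_eq_mul]
    ring
  rw [Finset.sum_congr rfl h, Finset.sum_const, Finset.card_range, nsmul_eq_mul]
  ring

variable {Ω : Type*} [MeasurableSpace Ω] {P : Measure Ω} {Y : ℕ → Ω → ℝ}

theorem integral_sum_sum {f : ℕ → ℕ → Ω → ℝ} (hf : ∀ i j, Integrable (f i j) P) {α β : ℝ}
    (hα : ∀ i, ∫ ω, f i i ω ∂P = α) (hβ : ∀ i j, i ≠ j → ∫ ω, f i j ω ∂P = β) (n : ℕ) :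
    ∫ ω, ∑ i ∈ Finset.range n, ∑ j ∈ Finset.range n, f i j ω ∂P =
      n * α + n * (n - 1) * β := by
  rw [integral_finsetSum _ fun i _ => integrable_finsetSum _ fun j _ => hf i j,
    ← sum_sum_ite_eq]
  refine Finset.sum_congr rfl fun i _ => ?_
  rw [integral_finsetSum _ fun j _ => hf i j]
  refine Finset.sum_congr rfl fun j _ => ?_
  split_ifs with h
  · rw [← h, hα]
  · exact hβ i j h

/-- The moments of a sequence of pairwise independent uniform variables that enter the expected
transport cost. -/
theorem uniform_moments [IsProbabilityMeasure P]
    (hlaw : ∀ i, HasLaw (Y i) (volume.restrict (Set.Icc 0 1)) P)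
    (hind : Pairwise fun i j => IndepFun (Y i) (Y j) P)
    (h01 : ∀ i ω, Y i ω ∈ Set.Icc (0 : ℝ) 1) (n : ℕ) :
    (Integrable (fun ω => ∑ i ∈ Finset.range n, Y i ω) P ∧
      ∫ ω, ∑ i ∈ Finset.range n, Y i ω ∂P = n / 2) ∧
    (Integrable (fun ω => ∑ i ∈ Finset.range n, Y i ω ^ 2) P ∧
      ∫ ω, ∑ i ∈ Finset.range n, Y i ω ^ 2 ∂P = n / 3) ∧
    (Integrable (fun ω => (∑ i ∈ Finset.range n, Y i ω) ^ 2) P ∧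
      ∫ ω, (∑ i ∈ Finset.range n, Y i ω) ^ 2 ∂P = n * (1 / 3) + n * (n - 1) * (1 / 4)) ∧
    (Integrable (fun ω => ∑ i ∈ Finset.range n, ∑ j ∈ Finset.range n, max (Y i ω) (Y j ω)) P ∧
      ∫ ω, ∑ i ∈ Finset.range n, ∑ j ∈ Finset.range n, max (Y i ω) (Y j ω) ∂P =
        n * (1 / 2) + n * (n - 1) * (2 / 3)) := by
  have hm : ∀ i, AEStronglyMeasurable (Y i) P := fun i =>
    (hlaw i).aemeasurable.aestronglyMeasurable
  have hexp : ∀ i (f : ℝ → ℝ), Continuous f →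
      ∫ ω, f (Y i ω) ∂P = ∫ x in (0 : ℝ)..1, f x := by
    intro i f hf
    rw [← setIntegral_unit, ← (hlaw i).map_eq,
      integral_map (hlaw i).aemeasurable hf.aestronglyMeasurable]
  have h1 : ∀ i, ∫ ω, Y i ω ∂P = 1 / 2 := fun i => by
    rw [hexp i (fun x => x) continuous_id, integral_id]
    norm_num
  have h2 : ∀ i, ∫ ω, Y i ω ^ 2 ∂P = 1 / 3 := fun i => by
    rw [hexp i (fun x => x ^ 2) (by fun_prop), integral_pow]
    norm_num
  have hi1 : ∀ i, Integrable (Y i) P := fun i =>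
    Integrable.of_bound (hm i) 1 (Eventually.of_forall fun ω =>
      abs_le.2 ⟨by linarith [(h01 i ω).1], (h01 i ω).2⟩)
  have hi2 : ∀ i j, Integrable (fun ω => Y i ω * Y j ω) P := fun i j =>
    Integrable.of_bound ((hm i).mul (hm j)) 1 (Eventually.of_forall fun ω => by
      have := h01 i ω
      have := h01 j ω
      exact abs_le.2 ⟨by nlinarith [(h01 i ω).1, (h01 j ω).1],
        mul_le_one₀ (h01 i ω).2 (h01 j ω).1 (h01 j ω).2⟩)
  have hi3 : ∀ i j, Integrable (fun ω => max (Y i ω) (Y j ω)) P := fun i j =>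
    (hi1 i).sup (hi1 j)
  have h3 : ∀ i j, i ≠ j → ∫ ω, Y i ω * Y j ω ∂P = 1 / 4 := by
    intro i j hij
    rw [(hind hij).integral_fun_mul_eq_mul_integral (hm i) (hm j), h1, h1]
    norm_num
  have h4 : ∀ i j, i ≠ j → ∫ ω, max (Y i ω) (Y j ω) ∂P = 2 / 3 := by
    intro i j hij
    have hmap := (indepFun_iff_map_prod_eq_prod_map_map (hlaw i).aemeasurable
      (hlaw j).aemeasurable).1 (hind hij)
    rw [(hlaw i).map_eq, (hlaw j).map_eq] at hmap
    have hpair : AEMeasurable (fun ω => (Y i ω, Y j ω)) P :=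
      (hlaw i).aemeasurable.prodMk (hlaw j).aemeasurable
    have hc : Continuous fun p : ℝ × ℝ => max p.1 p.2 := by fun_prop
    have e : ∫ ω, max (Y i ω) (Y j ω) ∂P =
        ∫ p : ℝ × ℝ, max p.1 p.2 ∂(P.map fun ω => (Y i ω, Y j ω)) :=
      (integral_map hpair hc.aestronglyMeasurable).symm
    have hint : Integrable (fun p : ℝ × ℝ => max p.1 p.2) (P.map fun ω => (Y i ω, Y j ω)) :=
      (integrable_map_measure hc.aestronglyMeasurable hpair).2 (hi3 i j)
    rw [hmap] at e hint
    rw [e, integral_prod _ hint, integral_integral_max]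
  have hsq : ∀ ω, (∑ i ∈ Finset.range n, Y i ω) ^ 2 =
      ∑ i ∈ Finset.range n, ∑ j ∈ Finset.range n, Y i ω * Y j ω := fun ω => by
    rw [sq, Finset.sum_mul_sum]
  simp only [hsq]
  refine ⟨⟨integrable_finsetSum _ fun i _ => hi1 i, ?_⟩,
    ⟨integrable_finsetSum _ fun i _ => ?_, ?_⟩,
    ⟨integrable_finsetSum _ fun i _ => integrable_finsetSum _ fun j _ => hi2 i j,
      integral_sum_sum hi2 (fun i => ?_) h3 n⟩,
    ⟨integrable_finsetSum _ fun i _ => integrable_finsetSum _ fun j _ => hi3 i j,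
      integral_sum_sum hi3 (fun i => ?_) h4 n⟩⟩
  · rw [integral_finsetSum _ fun i _ => hi1 i, Finset.sum_congr rfl fun i _ => h1 i]
    simp
    ring
  · simpa only [sq] using hi2 i i
  · rw [integral_finsetSum _ fun i _ => by simpa only [sq] using hi2 i i,
      Finset.sum_congr rfl fun i _ => h2 i]
    simp
    ring
  · simpa only [sq] using h2 i
  · simpa only [max_self] using h1 i

/-- The mean is `1/3 - (1/(2n) + (1 - 1/n) · 2/3) + 1/3 = 1/(6n)`. -/
theorem expected_wassersteinSq_unitInterval [IsProbabilityMeasure P]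
    {X : ℕ → Ω → unitInterval}
    (hX : ∀ i, HasLaw (X i) volume P) (hind : iIndepFun X P) {n : ℕ} (hn : 1 ≤ n) :
    Integrable (fun ω => (wassersteinSq (empiricalMeasure (fun i => X i ω) n) volume).toReal) P ∧
      n * ∫ ω, (wassersteinSq (empiricalMeasure (fun i => X i ω) n) volume).toReal ∂P = 1 / 6 := by
  have hn0 : (n : ℝ) ≠ 0 := by positivity
  obtain ⟨-, ⟨i2, e2⟩, -, ⟨i3, e3⟩⟩ := uniform_moments (P := P) (Y := fun i ω => (X i ω : ℝ))
    (fun i => HasLaw.comp ⟨unitInterval.measurePreserving_coe.measurable.aemeasurable,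
      unitInterval.measurePreserving_coe.map_eq⟩ (hX i))
    (fun i j hij => (hind.indepFun hij).comp measurable_subtype_coe measurable_subtype_coe)
    (fun i ω => (X i ω).2) n
  simp only [wassersteinSq_unitInterval _ hn]
  have j2 := i2.const_mul (n : ℝ)⁻¹
  have j3 := i3.const_mul ((n : ℝ) ^ 2)⁻¹
  have j23 := j2.sub j3
  simp only [Pi.sub_def] at j23
  refine ⟨j23.add (integrable_const _), ?_⟩
  rw [integral_add j23 (integrable_const _), integral_sub j2 j3, integral_const_mul,
    integral_const_mul, e2, e3, integral_const]
  simp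
  field_simp
  ring

theorem measurePreserving_coord :
    MeasurePreserving coord volume (volume.restrict (Set.Icc 0 1)) := by
  refine ⟨measurable_coord, ?_⟩
  have hmk := UnitAddCircle.measurePreserving_mk 0
  rw [← hmk.map_eq, Measure.map_map measurable_coord hmk.measurable]
  have hcongr : (coord ∘ fun t : ℝ => (t : UnitAddCircle)) =ᵐ[volume.restrict
      (Set.Ioc 0 (0 + 1))] id := by
    rw [EventuallyEq, ae_restrict_iff' measurableSet_Ioc]
    -- `coord` sends the class of `1` to `0`, so the identity fails at that single point.
    have : ∀ᵐ t : ℝ, t ≠ 1 := by simp [ae_iff]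
    filter_upwards [this] with t h1 ht
    rw [zero_add] at ht
    simp only [Function.comp, coord_coe, id]
    exact Int.fract_eq_self.2 ⟨ht.1.le, lt_of_le_of_ne ht.2 h1⟩
  rw [Measure.map_congr hcongr, Measure.map_id, zero_add,
    Measure.restrict_congr_set Ioc_ae_eq_Icc]

/-- The constants `1/3 - 1/4 + 1/2 - 2/3 + 1/12` cancel; the coefficient of `1/n` is `-1/3 + 1/4 -
1/2 + 2/3 = 1/12`. -/
theorem expected_wassersteinSq_circle [IsProbabilityMeasure P]
    {X : ℕ → Ω → UnitAddCircle}
    (hX : ∀ i, HasLaw (X i) volume P) (hind : iIndepFun X P) {n : ℕ} (hn : 1 ≤ n) :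
    Integrable (fun ω => (wassersteinSq (empiricalMeasure (fun i => X i ω) n) volume).toReal) P ∧
      n * ∫ ω, (wassersteinSq (empiricalMeasure (fun i => X i ω) n) volume).toReal ∂P =
        1 / 12 := by
  have hn0 : (n : ℝ) ≠ 0 := by positivity
  have hcoord : HasLaw coord (volume.restrict (Set.Icc 0 1)) volume :=
    ⟨measurable_coord.aemeasurable, measurePreserving_coord.map_eq⟩
  obtain ⟨⟨i1, e1⟩, ⟨i2, e2⟩, ⟨i3, e3⟩, ⟨i4, e4⟩⟩ :=
    uniform_moments (P := P) (Y := fun i ω => coord (X i ω))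
    (fun i => hcoord.comp (hX i))
    (fun i j hij => (hind.indepFun hij).comp measurable_coord measurable_coord)
    (fun i ω => Set.Ico_subset_Icc_self (coord_mem _)) n
  simp only [wassersteinSq_circle _ hn, mul_pow]
  have j1 := i1.const_mul (n : ℝ)⁻¹
  have j2 := i2.const_mul (n : ℝ)⁻¹
  have j3 := i3.const_mul ((n : ℝ)⁻¹ ^ 2)
  have j4 := i4.const_mul ((n : ℝ) ^ 2)⁻¹
  have j23 := j2.sub j3
  simp only [Pi.sub_def] at j23
  have j231 := j23.add j1
  simp only [Pi.add_def] at j231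
  have j2314 := j231.sub j4
  simp only [Pi.sub_def] at j2314
  refine ⟨j2314.add (integrable_const _), ?_⟩
  rw [integral_add j2314 (integrable_const _), integral_sub j231 j4, integral_add j23 j1,
    integral_sub j2 j3, integral_const_mul, integral_const_mul, integral_const_mul,
    integral_const_mul, e1, e2, e3, e4, integral_const]
  simp
  field_simp
  ring

end Expectation
end

end RandomMatching

/-! ### Comparison of the expected cost with the spectral series. -/

theorem theorem4p1 {Ω : Type*} [MeasurableSpace Ω] (P : Measure Ω) [IsProbabilityMeasure P] :
    -- the spectrum consists of eigenvalues of finite multiplicity, and the series converges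
    ((∀ l ∈ RandomMatching.operatorSpectrum RandomMatching.intervalLaplacian,
        0 < RandomMatching.multiplicity RandomMatching.intervalLaplacian l) ∧
      Summable (RandomMatching.spectralTerm RandomMatching.intervalLaplacian) ∧
      (∀ X : ℕ → Ω → unitInterval,
        (∀ i, HasLaw (X i) (volume : Measure unitInterval) P) → iIndepFun X P →
        (∀ n : ℕ, 1 ≤ n → Integrable (fun ω => (RandomMatching.wassersteinSq
          (RandomMatching.empiricalMeasure (fun i => X i ω) n) volume).toReal) P) ∧
        Tendsto (fun n : ℕ => (n : ℝ) * ∫ ω, (RandomMatching.wassersteinSq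
            (RandomMatching.empiricalMeasure (fun i => X i ω) n) volume).toReal ∂P) atTop
          (𝓝 (-∑' l, RandomMatching.spectralTerm RandomMatching.intervalLaplacian l))) ∧
      -∑' l, RandomMatching.spectralTerm RandomMatching.intervalLaplacian l = 1 / 6) ∧
    ((∀ l ∈ RandomMatching.operatorSpectrum RandomMatching.circleLaplacian,
        0 < RandomMatching.multiplicity RandomMatching.circleLaplacian l) ∧
      Summable (RandomMatching.spectralTerm RandomMatching.circleLaplacian) ∧
      (∀ X : ℕ → Ω → UnitAddCircle,
        (∀ i, HasLaw (X i) (volume : Measure UnitAddCircle) P) → iIndepFun X P →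
        (∀ n : ℕ, 1 ≤ n → Integrable (fun ω => (RandomMatching.wassersteinSq
          (RandomMatching.empiricalMeasure (fun i => X i ω) n) volume).toReal) P) ∧
        Tendsto (fun n : ℕ => (n : ℝ) * ∫ ω, (RandomMatching.wassersteinSq
            (RandomMatching.empiricalMeasure (fun i => X i ω) n) volume).toReal ∂P) atTop
          (𝓝 (-∑' l, RandomMatching.spectralTerm RandomMatching.circleLaplacian l))) ∧
      -∑' l, RandomMatching.spectralTerm RandomMatching.circleLaplacian l = 1 / 12) := by
  refine ⟨⟨RandomMatching.intervalLaplacian_spectral_sum.1,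
    RandomMatching.intervalLaplacian_spectral_sum.2.summable, fun X hX hind =>
      ⟨fun n hn => (RandomMatching.expected_wassersteinSq_unitInterval hX hind hn).1, ?_⟩, ?_⟩,
    ⟨RandomMatching.circleLaplacian_spectral_sum.1,
      RandomMatching.circleLaplacian_spectral_sum.2.summable, fun X hX hind =>
      ⟨fun n hn => (RandomMatching.expected_wassersteinSq_circle hX hind hn).1, ?_⟩, ?_⟩⟩
  · rw [RandomMatching.intervalLaplacian_spectral_sum.2.tsum_eq, neg_neg]
    -- The sequence is constant from `n = 1` on; at `n = 0` the factor `n` makes it zero.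
    refine tendsto_const_nhds.congr' ?_
    filter_upwards [eventually_ge_atTop 1] with n hn
    exact (RandomMatching.expected_wassersteinSq_unitInterval hX hind hn).2.symm
  · rw [RandomMatching.intervalLaplacian_spectral_sum.2.tsum_eq, neg_neg]
  · rw [RandomMatching.circleLaplacian_spectral_sum.2.tsum_eq, neg_neg]
    refine tendsto_const_nhds.congr' ?_
    filter_upwards [eventually_ge_atTop 1] with n hn
    exact (RandomMatching.expected_wassersteinSq_circle hX hind hn).2.symm
  · rw [RandomMatching.circleLaplacian_spectral_sum.2.tsum_eq, neg_neg]
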